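/- Fix $\sigma>0$, $\rho_1\ge 1$ and a sequence $(\alpha_n)_{n\ge0}$ of non-negative reals, not identically zero, with $\sum_{m\ge0} m\,\alpha_m\rho_1^m<\infty$. For $L\ge1$ let $(\gamma^{(L)}_0,\dots,\gamma^{(L)}_L)$ be a random Motzkin path of length $L$, i.e. a random sequence of non-negative integers with $|\gamma_k-\gamma_{k-1}|\le1$, where a path $\gamma$ is chosen with probability $$\Pr_L(\gamma)=\frac{1}{\mathfrak C_L}\,\alpha_{\gamma_0}\,\sigma^{h(\gamma)}\,\rho_1^{\gamma_L},$$ $h(\gamma)$ being the number of horizontal steps of $\gamma$ (up and down steps have weight $1$) and $\mathfrak C_L$ the normalizing constant, which is finite and positive. Set $\gamma^{(L)}_k=0$ for $k>L$, and let $\widetilde\gamma^{(L)}_k=\gamma^{(L)}_{L-k}-\gamma^{(L)}_L$ for $0\le k\le L$ and $\widetilde\gamma^{(L)}_k=0$ for $k>L$ be the reversed process. Then the laws of the right end points $\gamma^{(L)}_L$, $L\ge 1$, are not tight, and, as $L\to\infty$, $$\Big(\{\gamma^{(L)}_k\}_{k\ge0},\ \{\widetilde\gamma^{(L)}_k-\widetilde\gamma^{(L)}_{k-1}\}_{k\ge1}\Big)\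 \Longrightarrow\ \Big(\{Z_k\}_{k\ge0},\ \{\xi_k\}_{k\ge1}\Big)$$ (joint convergence in distribution, with respect to the product topology), where the families $\{Z_k\}$ and $\{\xi_k\}$ are independent and are as follows. With $$u_n=\frac{\rho_1^{n+1}-\rho_1^{-(n+1)}}{\rho_1-\rho_1^{-1}}\ \text{ if }\rho_1>1,\qquad u_n=n+1\ \text{ if }\rho_1=1,$$ $\{Z_k\}_{k\ge0}$ is the Markov chain on $\{0,1,2,\dots\}$ with initial law $\Pr(Z_0=n)=\alpha_nu_n/\sum_{m\ge0}\alpha_mu_m$ and transition probabilities $$\mathsf Q^{(\rho_1)}_{n,m}=\frac{1}{\rho_1+1/\rho_1+\sigma}\cdot\begin{cases}u_{n+1}/u_n,& m=n+1,\\ \sigma,& m=n,\\ u_{n-1}/u_n,& m=n-1\ge0,\\ 0,&\text{otherwise,}\end{cases}$$ and $\{\xi_k\}_{k\ge1}$ are i.i.d. with $$\Pr(\xi_1=1)=\frac{1/\rho_1}{\rho_1+1/\rho_1+\sigma},\quad \Pr(\xi_1=0)=\frac{\sigma}{\rho_1+1/\rho_1+\sigma},\quad \Pr(\xi_1=-1)=\frac{\rho_1}{\rho_1+1/\rho_1+\sigma}.$$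 -/

import Mathlib

open MeasureTheory ProbabilityTheory Filter
open scoped ENNReal Topology

noncomputable section

/-- A Motzkin path of length `L`: altitudes `γ₀, …, γ_L` in `ℕ` with steps in `{-1, 0, 1}`. -/
def MotzkinPath (L : ℕ) : Type :=
  {γ : Fin (L + 1) → ℕ // ∀ j : Fin L, |(γ j.succ : ℤ) - (γ j.castSucc : ℤ)| ≤ 1}

namespace MotzkinPath

/-- Every set of paths is an event (the set of paths is countable). -/
instance (L : ℕ) : MeasurableSpace (MotzkinPath L) := ⊤

/-- The edge weight: an up, horizontal or down step started at altitude `n` contributes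
`a n`, `b n` or `c n` respectively. -/
def weight (a b c : ℕ → ℝ) {L : ℕ} (γ : MotzkinPath L) : ℝ :=
  ∏ j : Fin L,
    if γ.1 j.castSucc < γ.1 j.succ then a (γ.1 j.castSucc)
    else if γ.1 j.succ = γ.1 j.castSucc then b (γ.1 j.castSucc)
    else c (γ.1 j.castSucc)

/-- The edge weight times the weights `α` and `β` of the two end points. -/
def fullWeight (a b c α β : ℕ → ℝ) {L : ℕ} (γ : MotzkinPath L) : ℝ :=
  α (γ.1 0) * weight a b c γ * β (γ.1 (Fin.last L))

/-- The normalizing constant `∑_{m,n} α_m 𝔚_{m,n} β_n`, as a sum over all paths of length `L`. -/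
def normConst (a b c α β : ℕ → ℝ) (L : ℕ) : ℝ≥0∞ :=
  ∑' γ : MotzkinPath L, ENNReal.ofReal (fullWeight a b c α β γ)

/-- The law of the random Motzkin path of length `L`. -/
def law (a b c α β : ℕ → ℝ) (L : ℕ) : Measure (MotzkinPath L) :=
  Measure.sum fun γ : MotzkinPath L =>
    (ENNReal.ofReal (fullWeight a b c α β γ) / normConst a b c α β L) • Measure.dirac γ

/-- The path seen from its left end point, continued by `0` after time `L`. -/
def left {L : ℕ} (γ : MotzkinPath L) (k : ℕ) : ℕ :=
  if h : k ≤ L then γ.1 ⟨k, Nat.lt_succ_of_le h⟩ else 0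

/-- The right end point `γ_L`. -/
def rightEnd {L : ℕ} (γ : MotzkinPath L) : ℕ := γ.1 (Fin.last L)

/-- The reversed process: `γ_{L-k} - γ_L` for `k ≤ L`, continued by `0` after time `L`. -/
def reversed {L : ℕ} (γ : MotzkinPath L) (k : ℕ) : ℤ :=
  if k ≤ L then (left γ (L - k) : ℤ) - (rightEnd γ : ℤ) else 0

/-- The increments of the reversed process; the index `k` stands for the step from time `k`
to time `k + 1`. -/
def reversedStep {L : ℕ} (γ : MotzkinPath L) (k : ℕ) : ℤ :=
  reversed γ (k + 1) - reversed γ k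

end MotzkinPath

/-- `(ρ^{n+1} - ρ^{-(n+1)}) / (ρ - ρ⁻¹)`, with its limit `n + 1` at the removable
singularity `ρ = 1`. -/
def chebRatio (ρ : ℝ) (n : ℕ) : ℝ :=
  if ρ = 1 then (n : ℝ) + 1 else (ρ ^ (n + 1) - (ρ ^ (n + 1))⁻¹) / (ρ - ρ⁻¹)

/-- The transition probability from `n` to `m` of the limiting chain. -/
def limitKernel (σ ρ : ℝ) (n m : ℕ) : ℝ :=
  if m = n + 1 then 1 / (ρ + 1 / ρ + σ) * (chebRatio ρ (n + 1) / chebRatio ρ n)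
  else if m = n then 1 / (ρ + 1 / ρ + σ) * σ
  else if m + 1 = n then 1 / (ρ + 1 / ρ + σ) * (chebRatio ρ m / chebRatio ρ n)
  else 0

/-- The initial law of the limiting chain. -/
def limitInit (α : ℕ → ℝ) (ρ : ℝ) (n : ℕ) : ℝ :=
  α n * chebRatio ρ n / ∑' m : ℕ, α m * chebRatio ρ m

/-- The law of one step of the limiting random walk at the right end. -/
def stepProb (σ ρ : ℝ) (e : ℤ) : ℝ :=
  1 / (ρ + 1 / ρ + σ) *
    (if e = 1 then 1 / ρ else if e = 0 then σ else if e = -1 then ρ else 0)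

/-- `Z` is a Markov chain on `ℕ` with initial law `ν` and transition probabilities `Q`
(the Markov property is written without dividing by the probability of the past). -/
structure IsMarkovChain {Ω : Type*} [MeasurableSpace Ω] (P : Measure Ω) (Z : ℕ → Ω → ℕ)
    (ν : ℕ → ℝ) (Q : ℕ → ℕ → ℝ) : Prop where
  measurable : ∀ k, Measurable (Z k)
  init : ∀ n, P.real {ω | Z 0 ω = n} = ν n
  step : ∀ (k : ℕ) (x : ℕ → ℕ),
    P.real {ω | ∀ j ≤ k + 1, Z j ω = x j} =
      P.real {ω | ∀ j ≤ k, Z j ω = x j} * Q (x k) (x (k + 1))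

/-- `Z` is the limiting Markov chain, the variables `ξ` are i.i.d. with the limiting step law,
and the two families are independent. The variable `ξ k` stands for the `(k+1)`-st step. -/
structure IsLimitPair {Ω : Type*} [MeasurableSpace Ω] (P : Measure Ω) (σ ρ : ℝ) (α : ℕ → ℝ)
    (Z : ℕ → Ω → ℕ) (ξ : ℕ → Ω → ℤ) : Prop where
  chain : IsMarkovChain P Z (limitInit α ρ) (limitKernel σ ρ)
  measurable_step : ∀ k, Measurable (ξ k)
  law_step : ∀ k e, P.real {ω | ξ k ω = e} = stepProb σ ρ e
  indep_step : iIndepFun ξ P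
  indep : IndepFun (fun ω k => Z k ω) (fun ω k => ξ k ω) P

end

/-!
The argument is a ratio limit theorem for the transfer operator
`(T g) n = g (n + 1) + σ g n + g (n - 1)` (no last term at `n = 0`): the weighted number of paths of
length `L` from `n` is `expSum σ ρ L n = (T ^ L) (ρ ^ ·) n`. Let `λ = ρ + 1 / ρ + σ` and
`u = chebRatio ρ`, so that `T u = λ u`.

The point is that excursions from `0` to `0` are negligible among all paths from `0`
(`tendsto_excursion_div`). It suffices to treat `ρ = 1`, where the excursion weights are the
differences of the survival probabilities `survival σ M` of a symmetric walk. Since `T` is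
symmetric, the excursion weights of even length are log-convex by Cauchy–Schwarz, so that their
ratios, normalized by `(2 + σ) ^ 2`, increase. If the ratios stay away from `1`, excursions decay
exponentially, while survival decays at most like `1 / M` by concavity in the starting point
(`expSum_le`). If they approach `1`, the survival probability exceeds a sum of arbitrarily many
comparable excursion probabilities.

Since `T (ρ ^ ·) = λ ρ ^ · - ρ⁻¹ δ₀`, this gives `expSum σ ρ (M + 1) 0 / expSum σ ρ M 0 → λ`, and the
recursion defining `T` then propagates to `expSum σ ρ M n / expSum σ ρ M 0 → u n`
(`tendsto_expSum_div`), with the bound `(n + 1) ρ ^ n` from concavity. It also shows that the number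
of paths ending at a fixed altitude is negligible, hence the right end point escapes.

The event that the first altitudes are `x` and the last steps are prescribed constrains each step
separately, so its probability factorizes into the weight of `x`, a power of `T`, and the weight of
the last steps (`law_boundaryEvent`). Far from `0` the latter is a product of step probabilities of
the random walk times `ρ ^ ·`, and paths ending near `0` do not count; the limit of the
probabilities is the telescoped product of the Doob transform of `T` by `u` and of the step law
(`tendsto_law_boundaryEvent`). The cylinder sets form a π-system that is a base of the topology, so
this is convergence in distribution.
-/

noncomputable section

/-! ### The transfer operator -/

/-- The transfer operator of Motzkin paths, `(T g) n = g (n + 1) + σ g n + g (n - 1)` with the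
last term absent at `n = 0`. The weighted number of paths of length `L` from `n`, with end point
weight `g`, is `(T ^ L) g n`. -/
def transfer (σ : ℝ) : Module.End ℝ (ℕ → ℝ) where
  toFun g n := g (n + 1) + σ * g n + (if n = 0 then 0 else g (n - 1))
  map_add' g h := by ext n; by_cases hn : n = 0 <;> simp [hn] <;> ring
  map_smul' c g := by ext n; by_cases hn : n = 0 <;> simp [hn] <;> ring

lemma transfer_zero (σ : ℝ) (g : ℕ → ℝ) : transfer σ g 0 = g 1 + σ * g 0 := by
  simp [transfer]

lemma transfer_succ (σ : ℝ) (g : ℕ → ℝ) (n : ℕ) :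
    transfer σ g (n + 1) = g (n + 2) + σ * g (n + 1) + g n := by
  simp [transfer]

lemma transfer_pow_succ (σ : ℝ) (M : ℕ) (g : ℕ → ℝ) :
    (transfer σ ^ (M + 1)) g = transfer σ ((transfer σ ^ M) g) := by
  rw [pow_succ']; rfl

lemma transfer_pow_succ' (σ : ℝ) (M : ℕ) (g : ℕ → ℝ) :
    (transfer σ ^ (M + 1)) g = (transfer σ ^ M) (transfer σ g) := by
  rw [pow_succ]; rfl

lemma transfer_pow_add (σ : ℝ) (M K : ℕ) (g : ℕ → ℝ) :
    (transfer σ ^ (M + K)) g = (transfer σ ^ M) ((transfer σ ^ K) g) := by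
  rw [pow_add]; rfl

lemma transfer_mono {σ : ℝ} (hσ : 0 ≤ σ) {g h : ℕ → ℝ} (hgh : g ≤ h) :
    transfer σ g ≤ transfer σ h := by
  intro n
  have h1 (k : ℕ) : σ * g k ≤ σ * h k := mul_le_mul_of_nonneg_left (hgh k) hσ
  cases n with
  | zero => rw [transfer_zero, transfer_zero]; linarith [hgh 1, h1 0]
  | succ n => rw [transfer_succ, transfer_succ]; linarith [hgh (n + 2), h1 (n + 1), hgh n]

lemma transfer_pow_mono {σ : ℝ} (hσ : 0 ≤ σ) (M : ℕ) {g h : ℕ → ℝ} (hgh : g ≤ h) :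
    (transfer σ ^ M) g ≤ (transfer σ ^ M) h := by
  induction M with
  | zero => simpa using hgh
  | succ M ih => rw [transfer_pow_succ, transfer_pow_succ]; exact transfer_mono hσ ih

lemma transfer_pow_nonneg {σ : ℝ} (hσ : 0 ≤ σ) (M : ℕ) {g : ℕ → ℝ} (hg : 0 ≤ g) :
    0 ≤ (transfer σ ^ M) g := by
  simpa using transfer_pow_mono hσ M hg

/-- An upward step has weight one. -/
lemma apply_succ_le_transfer {σ : ℝ} (hσ : 0 ≤ σ) {g : ℕ → ℝ} (hg : 0 ≤ g) (n : ℕ) :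
    g (n + 1) ≤ transfer σ g n := by
  have h1 (k : ℕ) : 0 ≤ σ * g k := mul_nonneg hσ (hg k)
  cases n with
  | zero => rw [transfer_zero]; linarith [h1 0]
  | succ n =>
    rw [transfer_succ]
    have := hg n
    simp only [Pi.zero_apply] at this
    linarith [h1 (n + 1)]

lemma apply_le_transfer_succ {σ : ℝ} (hσ : 0 ≤ σ) {g : ℕ → ℝ} (hg : 0 ≤ g) (n : ℕ) :
    g n ≤ transfer σ g (n + 1) := by
  have h1 (k : ℕ) : 0 ≤ σ * g k := mul_nonneg hσ (hg k)
  rw [transfer_succ]; have := hg (n + 2); simp only [Pi.zero_apply] at this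
  linarith [h1 (n + 1)]

lemma apply_le_transfer_pow_zero {σ : ℝ} (hσ : 0 ≤ σ) {g : ℕ → ℝ} (hg : 0 ≤ g) (n : ℕ) :
    g n ≤ (transfer σ ^ n) g 0 := by
  induction n generalizing g with
  | zero => simp
  | succ n ih =>
    rw [transfer_pow_succ']
    have hT : 0 ≤ transfer σ g := by simpa using transfer_pow_nonneg hσ 1 hg
    exact (apply_succ_le_transfer hσ hg n).trans (ih hT)

lemma apply_zero_le_transfer_pow {σ : ℝ} (hσ : 0 ≤ σ) {g : ℕ → ℝ} (hg : 0 ≤ g) (n : ℕ) :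
    g 0 ≤ (transfer σ ^ n) g n := by
  induction n with
  | zero => simp
  | succ n ih =>
    rw [transfer_pow_succ]
    exact ih.trans (apply_le_transfer_succ hσ (transfer_pow_nonneg hσ n hg) n)

lemma single_nonneg (y : ℕ) : (0 : ℕ → ℝ) ≤ Pi.single y 1 := by
  intro n
  by_cases h : n = y
  · subst h; simp
  · simp [h]

/-- The weight of the paths from `n` to `y` is at most the weight of the excursions obtained by
climbing from `0` to `n` before them and descending from `y` to `0` after them. -/
lemma transfer_pow_single_le {σ : ℝ} (hσ : 0 ≤ σ) (M n y : ℕ) :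
    (transfer σ ^ M) (Pi.single y 1) n ≤ (transfer σ ^ (M + (n + y))) (Pi.single 0 1) 0 := by
  have h0 : (Pi.single y 1 : ℕ → ℝ) ≤ (transfer σ ^ y) (Pi.single 0 1) := by
    intro k
    by_cases h : k = y
    · subst h
      simpa using apply_zero_le_transfer_pow hσ (single_nonneg 0) k
    · simpa [h] using transfer_pow_nonneg hσ y (single_nonneg 0) k
  calc _ ≤ (transfer σ ^ M) ((transfer σ ^ y) (Pi.single 0 1)) n := transfer_pow_mono hσ M h0 n
    _ ≤ (transfer σ ^ n) ((transfer σ ^ M) ((transfer σ ^ y) (Pi.single 0 1))) 0 :=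
      apply_le_transfer_pow_zero hσ
        (transfer_pow_nonneg hσ M (transfer_pow_nonneg hσ y (single_nonneg 0))) n
    _ = _ := by
      rw [← transfer_pow_add, ← transfer_pow_add, ← add_assoc, add_comm n M]

/-! ### Weighted path counts -/

/-- The weighted number of Motzkin paths of length `M` from `n`, with end point weight `ρ ^ k`
at altitude `k`. -/
def expSum (σ ρ : ℝ) (M n : ℕ) : ℝ := (transfer σ ^ M) (fun k => ρ ^ k) n

lemma expSum_zero (σ ρ : ℝ) (n : ℕ) : expSum σ ρ 0 n = ρ ^ n := rfl

lemma expSum_succ_zero (σ ρ : ℝ) (M : ℕ) :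
    expSum σ ρ (M + 1) 0 = expSum σ ρ M 1 + σ * expSum σ ρ M 0 := by
  rw [expSum, transfer_pow_succ, transfer_zero]; rfl

lemma expSum_succ_succ (σ ρ : ℝ) (M n : ℕ) :
    expSum σ ρ (M + 1) (n + 1) =
      expSum σ ρ M (n + 2) + σ * expSum σ ρ M (n + 1) + expSum σ ρ M n := by
  rw [expSum, transfer_pow_succ, transfer_succ]; rfl

lemma expSum_pos {σ ρ : ℝ} (hσ : 0 < σ) (hρ : 0 < ρ) (M n : ℕ) : 0 < expSum σ ρ M n := by
  induction M generalizing n with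
  | zero => exact pow_pos hρ n
  | succ M ih =>
    have h1 (k : ℕ) := mul_pos hσ (ih k)
    cases n with
    | zero => rw [expSum_succ_zero]; linarith [ih 1, h1 0]
    | succ n => rw [expSum_succ_succ]; linarith [ih (n + 2), h1 (n + 1), ih n]

/-- The exponential `ρ ^ n` is an eigenfunction of the transfer operator, up to the boundary
defect at `0`. -/
lemma transfer_exp {σ ρ : ℝ} (hρ : ρ ≠ 0) :
    transfer σ (fun k => ρ ^ k) =
      (ρ + 1 / ρ + σ) • (fun k => ρ ^ k : ℕ → ℝ) - (1 / ρ) • Pi.single 0 1 := by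
  ext n
  cases n with
  | zero => rw [transfer_zero]; simp; ring
  | succ n => rw [transfer_succ]; simp; field_simp; ring

lemma expSum_succ {σ ρ : ℝ} (hρ : ρ ≠ 0) (M n : ℕ) :
    expSum σ ρ (M + 1) n = (ρ + 1 / ρ + σ) * expSum σ ρ M n
      - 1 / ρ * (transfer σ ^ M) (Pi.single 0 1) n := by
  rw [expSum, transfer_pow_succ', transfer_exp hρ, map_sub, map_smul, map_smul]
  rfl

lemma expSum_succ_le {σ ρ : ℝ} (hσ : 0 < σ) (hρ : 0 < ρ) (M n : ℕ) :
    expSum σ ρ (M + 1) n ≤ (ρ + 1 / ρ + σ) * expSum σ ρ M n := by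
  rw [expSum_succ hρ.ne']
  have := mul_nonneg (one_div_pos.2 hρ).le (transfer_pow_nonneg hσ.le M (single_nonneg 0) n)
  linarith

lemma expSum_add_le {σ ρ : ℝ} (hσ : 0 < σ) (hρ : 0 < ρ) (M k n : ℕ) :
    expSum σ ρ (M + k) n ≤ (ρ + 1 / ρ + σ) ^ k * expSum σ ρ M n := by
  induction k with
  | zero => simp
  | succ k ih =>
    rw [← add_assoc]
    refine (expSum_succ_le hσ hρ _ n).trans ?_
    rw [pow_succ', mul_assoc]
    exact mul_le_mul_of_nonneg_left ih (by positivity)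

/-- `n ↦ ρ ^ (-n) * expSum σ ρ M n`, extended by `0` to `n = -1`, is concave: this holds for
`M = 0` and is preserved by the transfer operator. -/
lemma expSum_concave {σ ρ : ℝ} (hσ : 0 < σ) (hρ : 1 ≤ ρ) (M : ℕ) :
    expSum σ ρ M 1 ≤ 2 * ρ * expSum σ ρ M 0 ∧
      ∀ n, expSum σ ρ M (n + 2) + ρ ^ 2 * expSum σ ρ M n ≤ 2 * ρ * expSum σ ρ M (n + 1) := by
  induction M with
  | zero =>
    simp only [expSum_zero]
    refine ⟨by linarith, fun n => le_of_eq (by ring)⟩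
  | succ M ih =>
    obtain ⟨h0, h⟩ := ih
    have hσ0 := mul_le_mul_of_nonneg_left h0 hσ.le
    have hσn (n : ℕ) := mul_le_mul_of_nonneg_left (h n) hσ.le
    constructor
    · rw [expSum_succ_zero, expSum_succ_succ]
      have h2 : expSum σ ρ M 0 ≤ ρ ^ 2 * expSum σ ρ M 0 :=
        le_mul_of_one_le_left (expSum_pos hσ (by linarith) M 0).le (one_le_pow₀ hρ)
      linarith [h 0]
    · intro n
      cases n with
      | zero =>
        rw [expSum_succ_zero, expSum_succ_succ, expSum_succ_succ]
        linarith [h 1, hσn 0]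
      | succ n =>
        rw [expSum_succ_succ, expSum_succ_succ, expSum_succ_succ]
        linarith [h (n + 2), hσn (n + 1), h n]

/-- The concavity bound on the dependence on the starting point. -/
lemma expSum_le {σ ρ : ℝ} (hσ : 0 < σ) (hρ : 1 ≤ ρ) (M n : ℕ) :
    expSum σ ρ M n ≤ ((n : ℝ) + 1) * ρ ^ n * expSum σ ρ M 0 := by
  obtain ⟨h0, h⟩ := expSum_concave hσ hρ M
  have hstep (n : ℕ) : expSum σ ρ M (n + 1) ≤ ρ * expSum σ ρ M n + ρ ^ (n + 1) * expSum σ ρ M 0 := by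
    induction n with
    | zero => simp only [zero_add, pow_one]; linarith
    | succ n ih =>
      have := mul_le_mul_of_nonneg_left ih (show 0 ≤ ρ by linarith)
      have e : ρ * (ρ * expSum σ ρ M n + ρ ^ (n + 1) * expSum σ ρ M 0) =
        ρ ^ 2 * expSum σ ρ M n + ρ ^ (n + 1 + 1) * expSum σ ρ M 0 := by ring
      linarith [h n]
  induction n with
  | zero => simp
  | succ n ih =>
    refine (hstep n).trans ?_
    have := mul_le_mul_of_nonneg_left ih (show 0 ≤ ρ by linarith)
    push_cast
    calc _ ≤ _ := add_le_add_left this _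
      _ = _ := by ring

/-- A path of length `M` that starts at altitude `n ≥ M` does not feel the boundary. -/
lemma expSum_one_eq (σ : ℝ) {M n : ℕ} (h : M ≤ n) : expSum σ 1 M n = (2 + σ) ^ M := by
  induction M generalizing n with
  | zero => simp [expSum_zero]
  | succ M ih =>
    obtain ⟨k, rfl⟩ : ∃ k, n = k + 1 := ⟨n - 1, by omega⟩
    rw [expSum_succ_succ, ih (by omega), ih (by omega), ih (by omega)]; ring

/-- Survival for `M` steps has probability at least `1 / (M + 1)`: compare with the start at
altitude `M`, from which it is certain. -/
lemma pow_le_expSum_one {σ : ℝ} (hσ : 0 < σ) (M : ℕ) :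
    (2 + σ) ^ M ≤ ((M : ℝ) + 1) * expSum σ 1 M 0 := by
  have := expSum_le hσ le_rfl M M
  rwa [expSum_one_eq σ le_rfl, one_pow, mul_one] at this

lemma expSum_one_le {σ ρ : ℝ} (hσ : 0 < σ) (hρ : 1 ≤ ρ) (M n : ℕ) :
    expSum σ 1 M n ≤ expSum σ ρ M n :=
  transfer_pow_mono hσ.le M (fun k => by simpa using one_le_pow₀ hρ) n

/-! ### Log-convexity of the excursion weights -/

/-- The transfer operator is symmetric on finitely supported functions. -/
lemma transfer_symm (σ : ℝ) {N : ℕ} {f g : ℕ → ℝ} (hf : ∀ n, N ≤ n → f n = 0)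
    (hg : ∀ n, N ≤ n → g n = 0) :
    ∑ n ∈ Finset.range (N + 1), transfer σ f n * g n =
      ∑ n ∈ Finset.range (N + 1), f n * transfer σ g n := by
  rw [Finset.sum_range_succ', Finset.sum_range_succ']
  simp only [transfer_zero, transfer_succ]
  have e1 : ∑ n ∈ Finset.range N, f (n + 1) * g n =
      ∑ n ∈ Finset.range N, f (n + 2) * g (n + 1) + f 1 * g 0 := by
    rw [← Finset.sum_range_succ' (fun n => f (n + 1) * g n), Finset.sum_range_succ, hg N le_rfl]
    simp
  have e2 : ∑ n ∈ Finset.range N, f n * g (n + 1) =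
      ∑ n ∈ Finset.range N, f (n + 1) * g (n + 2) + f 0 * g 1 := by
    rw [← Finset.sum_range_succ' (fun n => f n * g (n + 1)), Finset.sum_range_succ, hf N le_rfl]
    simp
  have e3 : ∑ n ∈ Finset.range N, (f (n + 2) + σ * f (n + 1) + f n) * g (n + 1) =
      ∑ n ∈ Finset.range N, f (n + 2) * g (n + 1) +
      σ * ∑ n ∈ Finset.range N, f (n + 1) * g (n + 1) + ∑ n ∈ Finset.range N, f n * g (n + 1) := by
    rw [Finset.mul_sum, ← Finset.sum_add_distrib, ← Finset.sum_add_distrib]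
    exact Finset.sum_congr rfl fun n _ => by ring
  have e4 : ∑ n ∈ Finset.range N, f (n + 1) * (g (n + 2) + σ * g (n + 1) + g n) =
      ∑ n ∈ Finset.range N, f (n + 1) * g (n + 2) +
      σ * ∑ n ∈ Finset.range N, f (n + 1) * g (n + 1) + ∑ n ∈ Finset.range N, f (n + 1) * g n := by
    rw [Finset.mul_sum, ← Finset.sum_add_distrib, ← Finset.sum_add_distrib]
    exact Finset.sum_congr rfl fun n _ => by ring
  rw [e3, e4, e1, e2]; ring

/-- The weighted number of Motzkin excursions of length `M` at level `0`. -/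
def excursion (σ : ℝ) (M : ℕ) : ℝ := (transfer σ ^ M) (Pi.single 0 1) 0

lemma transfer_pow_single_zero_eq_zero (σ : ℝ) {M n : ℕ} (h : M < n) :
    (transfer σ ^ M) (Pi.single 0 1) n = 0 := by
  induction M generalizing n with
  | zero => simp [show n ≠ 0 by omega]
  | succ M ih =>
    obtain ⟨k, rfl⟩ : ∃ k, n = k + 1 := ⟨n - 1, by omega⟩
    rw [transfer_pow_succ, transfer_succ, ih (by omega), ih (by omega), ih (by omega)]; ring

/-- Cutting an excursion of length `i + j` at time `i`. -/
lemma excursion_add (σ : ℝ) {N : ℕ} (i j : ℕ) (h : i + j ≤ N) :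
    ∑ n ∈ Finset.range (N + 1),
      (transfer σ ^ i) (Pi.single 0 1) n * (transfer σ ^ j) (Pi.single 0 1) n =
        excursion σ (i + j) := by
  induction j generalizing i with
  | zero =>
    rw [Finset.sum_eq_single 0]
    · simp [excursion]
    · intro n _ hn; simp [hn]
    · simp
  | succ j ih =>
    rw [show i + (j + 1) = (i + 1) + j by ring, ← ih (i + 1) (by omega), transfer_pow_succ,
      transfer_pow_succ]
    exact (transfer_symm σ (fun n hn => transfer_pow_single_zero_eq_zero σ (by omega))
      (fun n hn => transfer_pow_single_zero_eq_zero σ (by omega))).symm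

/-- Log-convexity in the even lengths, by the Cauchy–Schwarz inequality. -/
lemma excursion_sq_le (σ : ℝ) (m : ℕ) :
    excursion σ (2 * (m + 1)) ^ 2 ≤ excursion σ (2 * m) * excursion σ (2 * (m + 2)) := by
  have h (i j : ℕ) (h : i + j ≤ 2 * m + 4) := excursion_add σ i j h
  rw [show 2 * (m + 1) = m + (m + 2) by ring, show 2 * m = m + m by ring,
    show 2 * (m + 2) = (m + 2) + (m + 2) by ring, ← h m (m + 2) (by omega), ← h m m (by omega),
    ← h (m + 2) (m + 2) (by omega)]
  simp only [← pow_two]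
  exact Finset.sum_mul_sq_le_sq_mul_sq _ _ _

lemma excursion_pos {σ : ℝ} (hσ : 0 < σ) (M : ℕ) : 0 < excursion σ M := by
  rw [excursion]
  induction M with
  | zero => simp
  | succ M ih =>
    rw [transfer_pow_succ, transfer_zero]
    have := transfer_pow_nonneg hσ.le M (single_nonneg 0) 1
    simp only [Pi.zero_apply] at this
    linarith [mul_pos hσ ih]

/-! ### Excursions are negligible -/

lemma excursion_eq {σ : ℝ} (M : ℕ) :
    excursion σ M = (2 + σ) * expSum σ 1 M 0 - expSum σ 1 (M + 1) 0 := by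
  rw [expSum_succ one_ne_zero, excursion]; ring

/-- The probability that the walk from `0` with symmetric steps, of weights `1`, `σ`, `1`, stays
non-negative for `M` steps. -/
def survival (σ : ℝ) (M : ℕ) : ℝ := expSum σ 1 M 0 / (2 + σ) ^ M

lemma survival_pos {σ : ℝ} (hσ : 0 < σ) (M : ℕ) : 0 < survival σ M :=
  div_pos (expSum_pos hσ one_pos M 0) (by positivity)

lemma survival_sub {σ : ℝ} (hσ : 0 < σ) (M : ℕ) :
    survival σ M - survival σ (M + 1) = excursion σ M / (2 + σ) ^ (M + 1) := by
  rw [excursion_eq, survival, survival, pow_succ]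
  field_simp

lemma survival_antitone {σ : ℝ} (hσ : 0 < σ) : Antitone (survival σ) := by
  refine antitone_nat_of_succ_le fun M => ?_
  have := survival_sub hσ M
  have h2 : 0 < excursion σ M / (2 + σ) ^ (M + 1) := div_pos (excursion_pos hσ M) (by positivity)
  linarith

/-- The probability that the symmetric walk from `0` becomes negative exactly at step `2 m + 1`,
after an excursion of length `2 m`. -/
def evenReturn (σ : ℝ) (m : ℕ) : ℝ := excursion σ (2 * m) / (2 + σ) ^ (2 * m + 1)

lemma evenReturn_pos {σ : ℝ} (hσ : 0 < σ) (m : ℕ) : 0 < evenReturn σ m :=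
  div_pos (excursion_pos hσ _) (by positivity)

lemma sum_evenReturn_le {σ : ℝ} (hσ : 0 < σ) (m I : ℕ) :
    ∑ i ∈ Finset.range I, evenReturn σ (m + i) ≤ survival σ (2 * m) - survival σ (2 * (m + I)) := by
  induction I with
  | zero => simp
  | succ I ih =>
    rw [Finset.sum_range_succ, evenReturn, ← survival_sub hσ]
    have := survival_antitone hσ (show 2 * (m + I) + 1 ≤ 2 * (m + (I + 1)) by omega)
    linarith

lemma evenReturn_sq_le {σ : ℝ} (hσ : 0 < σ) (m : ℕ) :
    evenReturn σ (m + 1) ^ 2 ≤ evenReturn σ m * evenReturn σ (m + 2) := by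
  rw [evenReturn, evenReturn, evenReturn, div_pow, div_mul_div_comm, ← pow_mul, ← pow_add,
    show (2 * (m + 1) + 1) * 2 = 2 * m + 1 + (2 * (m + 2) + 1) by ring]
  exact div_le_div_of_nonneg_right (excursion_sq_le σ m) (by positivity)

/-- The ratio of consecutive return probabilities; it increases, by log-convexity. -/
def returnRatio (σ : ℝ) (m : ℕ) : ℝ := evenReturn σ (m + 1) / evenReturn σ m

lemma returnRatio_pos {σ : ℝ} (hσ : 0 < σ) (m : ℕ) : 0 < returnRatio σ m :=
  div_pos (evenReturn_pos hσ _) (evenReturn_pos hσ _)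

lemma returnRatio_monotone {σ : ℝ} (hσ : 0 < σ) : Monotone (returnRatio σ) := by
  refine monotone_nat_of_le_succ fun m => ?_
  rw [returnRatio, returnRatio, div_le_div_iff₀ (evenReturn_pos hσ _) (evenReturn_pos hσ _)]
  have := evenReturn_sq_le hσ m
  rw [pow_two] at this
  linarith

/-- The return probabilities `evenReturn σ (m + i)` dominate a geometric sequence in `i` whose
ratio is the current value of `returnRatio`. -/
lemma mul_pow_le_evenReturn {σ : ℝ} (hσ : 0 < σ) (m i : ℕ) :
    evenReturn σ m * returnRatio σ m ^ i ≤ evenReturn σ (m + i) := by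
  induction i with
  | zero => simp
  | succ i ih =>
    have h : evenReturn σ (m + (i + 1)) = evenReturn σ (m + i) * returnRatio σ (m + i) := by
      rw [returnRatio, mul_div_cancel₀ _ (evenReturn_pos hσ _).ne']; rfl
    rw [h, pow_succ, ← mul_assoc]
    exact mul_le_mul ih (returnRatio_monotone hσ (by omega)) (returnRatio_pos hσ m).le
      (evenReturn_pos hσ _).le

lemma evenReturn_le_pow {σ : ℝ} (hσ : 0 < σ) {r : ℝ} (hr : ∀ m, returnRatio σ m ≤ r) (m : ℕ) :
    evenReturn σ m ≤ evenReturn σ 0 * r ^ m := by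
  induction m with
  | zero => simp
  | succ m ih =>
    have h : evenReturn σ (m + 1) = evenReturn σ m * returnRatio σ m := by
      rw [returnRatio, mul_div_cancel₀ _ (evenReturn_pos hσ _).ne']
    rw [h, pow_succ, ← mul_assoc]
    exact mul_le_mul ih (hr m) (returnRatio_pos hσ m).le
      ((evenReturn_pos hσ _).le.trans ih)

lemma one_le_survival {σ : ℝ} (hσ : 0 < σ) (M : ℕ) : 1 ≤ ((M : ℝ) + 1) * survival σ M := by
  rw [survival, mul_div_assoc', le_div_iff₀ (by positivity), one_mul]
  exact pow_le_expSum_one hσ M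

/-- The return probability is negligible against the survival probability. Either all ratios stay
below some `r < 1`, and then the return probability decays exponentially whereas survival decays at
most like `1 / M`; or the ratios approach `1`, and then survival is at least the sum of many return
probabilities of comparable size. -/
lemma tendsto_evenReturn_div_survival {σ : ℝ} (hσ : 0 < σ) :
    Tendsto (fun m => evenReturn σ m / survival σ (2 * m)) atTop (𝓝 0) := by
  have hnn (m : ℕ) : 0 ≤ evenReturn σ m / survival σ (2 * m) :=
    (div_pos (evenReturn_pos hσ _) (survival_pos hσ _)).le
  by_cases h : ∃ r < 1, ∀ m, returnRatio σ m ≤ r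
  · obtain ⟨r, hr1, hr⟩ := h
    have hr0 : 0 < r := (returnRatio_pos hσ 0).trans_le (hr 0)
    have hlim : Tendsto (fun m : ℕ => evenReturn σ 0 * (2 * ((m : ℝ) * r ^ m) + r ^ m)) atTop
        (𝓝 0) := by
      have h1 := tendsto_self_mul_const_pow_of_lt_one hr0.le hr1
      have h2 := tendsto_pow_atTop_nhds_zero_of_lt_one hr0.le hr1
      simpa using ((h1.const_mul 2).add h2).const_mul (evenReturn σ 0)
    refine squeeze_zero hnn (fun m => ?_) hlim
    rw [div_le_iff₀ (survival_pos hσ _)]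
    have h1 := evenReturn_le_pow hσ hr m
    have h2 := one_le_survival hσ (2 * m)
    push_cast at h2
    calc evenReturn σ m ≤ evenReturn σ 0 * r ^ m * 1 := by rwa [mul_one]
      _ ≤ evenReturn σ 0 * r ^ m * ((2 * (m : ℝ) + 1) * survival σ (2 * m)) :=
        mul_le_mul_of_nonneg_left h2 (mul_nonneg (evenReturn_pos hσ 0).le (pow_pos hr0 m).le)
      _ = _ := by ring
  · push Not at h
    refine Metric.tendsto_atTop.2 fun ε hε => ?_
    -- `I` terms, each at least half of `evenReturn σ m`, add up to more than `evenReturn σ m / ε`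
    obtain ⟨I, hI⟩ := exists_nat_gt (2 / ε)
    have hIpos : (0 : ℝ) < I := lt_trans (by positivity) hI
    have hI1 : 1 ≤ I := by exact_mod_cast hIpos
    obtain ⟨m₀, hm₀⟩ := h (1 - 1 / (2 * I)) (by
      have : (0 : ℝ) < 1 / (2 * I) := by positivity
      linarith)
    refine ⟨m₀, fun m hm => ?_⟩
    rw [Real.dist_eq, sub_zero, abs_of_nonneg (hnn m), div_lt_iff₀ (survival_pos hσ _)]
    set q := returnRatio σ m with hq
    have hqge : 1 - 1 / (2 * (I : ℝ)) ≤ q := hm₀.le.trans (returnRatio_monotone hσ hm)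
    have hle : (1 : ℝ) / (2 * I) ≤ 1 / 2 := by
      have : (1 : ℝ) ≤ I := by exact_mod_cast hI1
      exact one_div_le_one_div_of_le (by norm_num) (by linarith)
    -- Bernoulli: each of the first `I` terms is at least half of the leading one
    have hpow (i : ℕ) (hi : i < I) : (1 : ℝ) / 2 ≤ q ^ i := by
      have hb := one_add_mul_le_pow (a := -(1 / (2 * (I : ℝ)))) (by linarith) i
      have h3 : (i : ℝ) * (1 / (2 * I)) ≤ 1 / 2 := by
        have : (i : ℝ) ≤ I := by exact_mod_cast hi.le
        rw [mul_one_div, div_le_iff₀ (by positivity)]; linarith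
      calc (1 : ℝ) / 2 ≤ 1 + i * -(1 / (2 * (I : ℝ))) := by linarith
        _ ≤ _ := hb
        _ ≤ q ^ i := pow_le_pow_left₀ (by linarith) (by linarith) i
    have hsum : (I : ℝ) * (evenReturn σ m * (1 / 2)) ≤ survival σ (2 * m) := by
      have h4 := sum_evenReturn_le hσ m I
      have h5 : ∑ _i ∈ Finset.range I, evenReturn σ m * (1 / 2) ≤
          ∑ i ∈ Finset.range I, evenReturn σ (m + i) :=
        Finset.sum_le_sum fun i hi =>
          (mul_le_mul_of_nonneg_left (hpow i (Finset.mem_range.1 hi)) (evenReturn_pos hσ m).le).trans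
            (mul_pow_le_evenReturn hσ m i)
      rw [Finset.sum_const, Finset.card_range, nsmul_eq_mul] at h5
      linarith [survival_pos hσ (2 * (m + I))]
    rw [div_lt_iff₀ hε] at hI
    have h6 : evenReturn σ m * 2 < evenReturn σ m * (I * ε) :=
      mul_lt_mul_of_pos_left hI (evenReturn_pos hσ m)
    have h7 := mul_le_mul_of_nonneg_left hsum hε.le
    linarith

lemma tendsto_excursion_even {σ : ℝ} (hσ : 0 < σ) :
    Tendsto (fun m => excursion σ (2 * m) / expSum σ 1 (2 * m) 0) atTop (𝓝 0) := by
  have h := (tendsto_evenReturn_div_survival hσ).const_mul (2 + σ)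
  rw [mul_zero] at h
  refine h.congr fun m => ?_
  rw [evenReturn, survival, pow_succ]
  have := (expSum_pos hσ one_pos (2 * m) 0).ne'
  field_simp

/-- Excursions are negligible among the paths from `0`. -/
lemma tendsto_excursion_div {σ ρ : ℝ} (hσ : 0 < σ) (hρ : 1 ≤ ρ) :
    Tendsto (fun M => excursion σ M / expSum σ ρ M 0) atTop (𝓝 0) := by
  -- bound an excursion of any length by one of the next even length
  have hodd (M : ℕ) : excursion σ M / expSum σ 1 M 0 ≤
      ((2 + σ) / σ + 1) * (excursion σ (2 * ((M + 1) / 2)) / expSum σ 1 (2 * ((M + 1) / 2)) 0) := by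
    rcases Nat.even_or_odd' M with ⟨m, rfl | rfl⟩
    · rw [show (2 * m + 1) / 2 = m by omega]
      refine le_mul_of_one_le_left
        (div_pos (excursion_pos hσ _) (expSum_pos hσ one_pos _ _)).le ?_
      have : 0 < (2 + σ) / σ := by positivity
      linarith
    · rw [show (2 * m + 1 + 1) / 2 = m + 1 by omega, show 2 * (m + 1) = 2 * m + 1 + 1 by ring]
      have h1 : σ * excursion σ (2 * m + 1) ≤ excursion σ (2 * m + 1 + 1) := by
        rw [excursion, excursion, transfer_pow_succ σ (2 * m + 1), transfer_zero]
        have := transfer_pow_nonneg hσ.le (2 * m + 1) (single_nonneg 0) 1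
        simp only [Pi.zero_apply] at this
        linarith
      have h2 := expSum_succ_le hσ one_pos (2 * m + 1) 0
      have e1 := excursion_pos hσ (2 * m + 1)
      have e2 := excursion_pos hσ (2 * m + 1 + 1)
      have s1 := expSum_pos hσ one_pos (2 * m + 1) 0
      have s2 := expSum_pos hσ one_pos (2 * m + 1 + 1) 0
      have h3 : excursion σ (2 * m + 1) / expSum σ 1 (2 * m + 1) 0 ≤
          (2 + σ) / σ * (excursion σ (2 * m + 1 + 1) / expSum σ 1 (2 * m + 1 + 1) 0) := by
        rw [div_mul_div_comm, div_le_div_iff₀ s1 (by positivity)]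
        calc excursion σ (2 * m + 1) * (σ * expSum σ 1 (2 * m + 1 + 1) 0)
            = (σ * excursion σ (2 * m + 1)) * expSum σ 1 (2 * m + 1 + 1) 0 := by ring
          _ ≤ excursion σ (2 * m + 1 + 1) * ((1 + 1 / 1 + σ) * expSum σ 1 (2 * m + 1) 0) :=
            mul_le_mul h1 h2 s2.le e2.le
          _ = _ := by ring
      have h4 := (div_pos e2 s2).le
      linarith
  have hhalf : Tendsto (fun M : ℕ => (M + 1) / 2) atTop atTop :=
    tendsto_atTop.2 fun b => eventually_atTop.2 ⟨2 * b, fun M hM => by omega⟩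
  have hlim := ((tendsto_excursion_even hσ).comp hhalf).const_mul ((2 + σ) / σ + 1)
  rw [mul_zero] at hlim
  refine squeeze_zero (fun M => (div_pos (excursion_pos hσ M)
    (expSum_pos hσ (by linarith) M 0)).le) (fun M => ?_) hlim
  refine le_trans ?_ (hodd M)
  exact div_le_div_of_nonneg_left (excursion_pos hσ M).le (expSum_pos hσ one_pos M 0)
    (expSum_one_le hσ hρ M 0)

/-- The end point escapes: the paths from `n` to a fixed altitude `y` are negligible. -/
lemma tendsto_transfer_pow_single_div {σ ρ : ℝ} (hσ : 0 < σ) (hρ : 1 ≤ ρ) (n y : ℕ) :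
    Tendsto (fun M => (transfer σ ^ M) (Pi.single y 1) n / expSum σ ρ M 0) atTop (𝓝 0) := by
  have hρ0 : 0 < ρ := by linarith
  have hlim := ((tendsto_excursion_div hσ hρ).comp (tendsto_add_atTop_nat (n + y))).const_mul
    ((ρ + 1 / ρ + σ) ^ (n + y))
  rw [mul_zero] at hlim
  refine squeeze_zero (fun M => div_nonneg (transfer_pow_nonneg hσ.le M (single_nonneg y) n)
    (expSum_pos hσ hρ0 M 0).le) (fun M => ?_) hlim
  have h1 := expSum_add_le hσ hρ0 M (n + y) 0
  have h2 := transfer_pow_single_le hσ.le M n y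
  have s1 := expSum_pos hσ hρ0 M 0
  have s2 := expSum_pos hσ hρ0 (M + (n + y)) 0
  have e := excursion_pos hσ (M + (n + y))
  simp only [Function.comp_apply]
  rw [mul_div_assoc', div_le_div_iff₀ s1 s2]
  calc _ ≤ excursion σ (M + (n + y)) * ((ρ + 1 / ρ + σ) ^ (n + y) * expSum σ ρ M 0) :=
        mul_le_mul h2 h1 s2.le e.le
    _ = _ := by ring

lemma tendsto_expSum_succ_div {σ ρ : ℝ} (hσ : 0 < σ) (hρ : 1 ≤ ρ) :
    Tendsto (fun M => expSum σ ρ (M + 1) 0 / expSum σ ρ M 0) atTop (𝓝 (ρ + 1 / ρ + σ)) := by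
  have hρ0 : 0 < ρ := by linarith
  have h := ((tendsto_excursion_div hσ hρ).const_mul (1 / ρ)).const_sub (ρ + 1 / ρ + σ)
  rw [mul_zero, sub_zero] at h
  refine h.congr fun M => ?_
  have s1 := (expSum_pos hσ hρ0 M 0).ne'
  rw [expSum_succ hρ0.ne', excursion, sub_div, mul_div_assoc, mul_div_assoc, div_self s1, mul_one]

lemma tendsto_expSum_add_div {σ ρ : ℝ} (hσ : 0 < σ) (hρ : 1 ≤ ρ) (k : ℕ) :
    Tendsto (fun M => expSum σ ρ (M + k) 0 / expSum σ ρ M 0) atTop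
      (𝓝 ((ρ + 1 / ρ + σ) ^ k)) := by
  have hρ0 : 0 < ρ := by linarith
  induction k with
  | zero =>
    refine tendsto_const_nhds.congr fun M => ?_
    rw [pow_zero, add_zero, div_self (expSum_pos hσ hρ0 M 0).ne']
  | succ k ih =>
    rw [pow_succ']
    refine (((tendsto_expSum_succ_div hσ hρ).comp (tendsto_add_atTop_nat k)).mul ih).congr
      fun M => ?_
    exact div_mul_div_cancel₀ (expSum_pos hσ hρ0 (M + k) 0).ne'

/-! ### The harmonic function -/

lemma chebRatio_zero {ρ : ℝ} (hρ : 1 ≤ ρ) : chebRatio ρ 0 = 1 := by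
  rw [chebRatio]
  split_ifs with h
  · simp
  · have h1 : 1 < ρ := lt_of_le_of_ne hρ (Ne.symm h)
    have : ρ - ρ⁻¹ ≠ 0 := by
      have := inv_lt_one_of_one_lt₀ h1
      linarith
    simp [div_self this]

lemma chebRatio_one {ρ : ℝ} (hρ : 1 ≤ ρ) : chebRatio ρ 1 = ρ + 1 / ρ := by
  rw [chebRatio]
  split_ifs with h
  · subst h; norm_num
  · have h1 : 1 < ρ := lt_of_le_of_ne hρ (Ne.symm h)
    have h2 : ρ ≠ 0 := by linarith
    have : ρ - ρ⁻¹ ≠ 0 := by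
      have := inv_lt_one_of_one_lt₀ h1
      linarith
    rw [div_eq_iff this]; field_simp; ring

lemma chebRatio_add_two {ρ : ℝ} (hρ : 1 ≤ ρ) (n : ℕ) :
    chebRatio ρ (n + 2) = (ρ + 1 / ρ) * chebRatio ρ (n + 1) - chebRatio ρ n := by
  simp only [chebRatio]
  split_ifs with h
  · subst h; push_cast; ring
  · have h2 : ρ ≠ 0 := by linarith
    rw [mul_div_assoc', ← sub_div]
    congr 1
    field_simp; ring

lemma chebRatio_pos {ρ : ℝ} (hρ : 1 ≤ ρ) (n : ℕ) : 0 < chebRatio ρ n := by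
  rw [chebRatio]
  split_ifs with h
  · positivity
  · have h1 : 1 < ρ := lt_of_le_of_ne hρ (Ne.symm h)
    have h2 := inv_lt_one_of_one_lt₀ h1
    have h3 : 1 < ρ ^ (n + 1) := one_lt_pow₀ h1 n.succ_ne_zero
    have h4 := inv_lt_one_of_one_lt₀ h3
    exact div_pos (by linarith) (by linarith)

/-- The limiting harmonic function: `chebRatio ρ` satisfies the recursion that the ratios
`expSum σ ρ M n / expSum σ ρ M 0` satisfy in the limit. -/
lemma tendsto_expSum_div {σ ρ : ℝ} (hσ : 0 < σ) (hρ : 1 ≤ ρ) (n : ℕ) :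
    Tendsto (fun M => expSum σ ρ M n / expSum σ ρ M 0) atTop (𝓝 (chebRatio ρ n)) := by
  have hρ0 : 0 < ρ := by linarith
  have hN (M : ℕ) := (expSum_pos hσ hρ0 M 0).ne'
  induction n using Nat.twoStepInduction with
  | zero =>
    rw [chebRatio_zero hρ]
    exact tendsto_const_nhds.congr fun M => (div_self (hN M)).symm
  | one =>
    rw [chebRatio_one hρ]
    have h := (tendsto_expSum_succ_div hσ hρ).sub_const σ
    rw [add_sub_cancel_right] at h
    refine h.congr fun M => ?_
    rw [expSum_succ_zero, add_div, mul_div_assoc, div_self (hN M)]; ring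
  | more n ih0 ih1 =>
    rw [chebRatio_add_two hρ]
    have h1 := (ih1.comp (tendsto_add_atTop_nat 1)).mul (tendsto_expSum_succ_div hσ hρ)
    have h := (h1.sub (ih1.const_mul σ)).sub ih0
    rw [show chebRatio ρ (n + 1) * (ρ + 1 / ρ + σ) - σ * chebRatio ρ (n + 1) - chebRatio ρ n =
      (ρ + 1 / ρ) * chebRatio ρ (n + 1) - chebRatio ρ n by ring] at h
    refine h.congr fun M => ?_
    simp only [Function.comp_apply]
    rw [div_mul_div_cancel₀ (hN (M + 1)), expSum_succ_succ]
    ring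

lemma chebRatio_le {ρ : ℝ} (hρ : 1 ≤ ρ) (n : ℕ) : chebRatio ρ n ≤ ((n : ℝ) + 1) * ρ ^ n := by
  refine le_of_tendsto (tendsto_expSum_div one_pos hρ n) (.of_forall fun M => ?_)
  rw [div_le_iff₀ (expSum_pos one_pos (by linarith) M 0)]
  exact expSum_le one_pos hρ M n

/-- `chebRatio ρ` is harmonic for the transfer operator. -/
lemma transfer_chebRatio {ρ : ℝ} (σ : ℝ) (hρ : 1 ≤ ρ) (n : ℕ) :
    transfer σ (chebRatio ρ) n = (ρ + 1 / ρ + σ) * chebRatio ρ n := by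
  cases n with
  | zero => rw [transfer_zero, chebRatio_one hρ, chebRatio_zero hρ]; ring
  | succ n => rw [transfer_succ, chebRatio_add_two hρ]; ring

/-! ### Path sums with prescribed steps -/

/-- The weight of a step from altitude `n` to altitude `m`. -/
def stepWeight (σ : ℝ) (n m : ℕ) : ℝ :=
  if m = n + 1 then 1 else if m = n then σ else if m + 1 = n then 1 else 0

lemma stepWeight_nonneg {σ : ℝ} (hσ : 0 ≤ σ) (n m : ℕ) : 0 ≤ stepWeight σ n m := by
  rw [stepWeight]; split_ifs <;> simp [hσ]

/-- The transfer operator as a sum over one step. -/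
lemma hasSum_stepWeight_mul (σ : ℝ) (g : ℕ → ℝ) (n : ℕ) :
    HasSum (fun m => stepWeight σ n m * g m) (transfer σ g n) := by
  cases n with
  | zero =>
    have h := hasSum_sum_of_ne_finset_zero (L := .unconditional ℕ)
      (f := fun m => stepWeight σ 0 m * g m)
      (s := {1, 0}) (fun m hm => by
        simp only [Finset.mem_insert, Finset.mem_singleton, not_or] at hm
        simp [stepWeight, hm.1, hm.2])
    rw [Finset.sum_pair one_ne_zero] at h
    rw [transfer_zero]
    simpa [stepWeight] using h
  | succ n =>
    have h := hasSum_sum_of_ne_finset_zero (L := .unconditional ℕ)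
      (f := fun m => stepWeight σ (n + 1) m * g m)
      (s := {n + 2, n + 1, n}) (fun m hm => by
        simp only [Finset.mem_insert, Finset.mem_singleton, not_or] at hm
        simp [stepWeight, hm.1, hm.2.1, hm.2.2])
    rw [Finset.sum_insert (by simp), Finset.sum_pair (by simp)] at h
    rw [transfer_succ, add_assoc]
    simpa [stepWeight] using h

/-- The total weight of the paths of length `L` from `n` when the `j`-th step has weight `w j` and
the end point has weight `b`. -/
def pathSum (w : ℕ → ℕ → ℕ → ℝ≥0∞) : ℕ → (ℕ → ℝ≥0∞) → ℕ → ℝ≥0∞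
  | 0, b, n => b n
  | L + 1, b, n => ∑' m, w 0 n m * pathSum (fun j => w (j + 1)) L b m
termination_by L => L

lemma pathSum_zero (w : ℕ → ℕ → ℕ → ℝ≥0∞) (b : ℕ → ℝ≥0∞) (n : ℕ) : pathSum w 0 b n = b n := by
  rw [pathSum]

lemma pathSum_succ (w : ℕ → ℕ → ℕ → ℝ≥0∞) (L : ℕ) (b : ℕ → ℝ≥0∞) (n : ℕ) :
    pathSum w (L + 1) b n = ∑' m, w 0 n m * pathSum (fun j => w (j + 1)) L b m := by
  rw [pathSum]

lemma pathSum_congr {w w' : ℕ → ℕ → ℕ → ℝ≥0∞} {L : ℕ} (h : ∀ j < L, w j = w' j)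
    (b : ℕ → ℝ≥0∞) (n : ℕ) : pathSum w L b n = pathSum w' L b n := by
  induction L generalizing w w' n with
  | zero => rw [pathSum_zero, pathSum_zero]
  | succ L ih =>
    rw [pathSum_succ, pathSum_succ, h 0 (by omega)]
    exact tsum_congr fun m => by rw [ih fun j hj => h (j + 1) (by omega)]

/-- Cutting the paths at time `K`. -/
lemma pathSum_add (w : ℕ → ℕ → ℕ → ℝ≥0∞) (K L : ℕ) (b : ℕ → ℝ≥0∞) (n : ℕ) :
    pathSum w (K + L) b n = pathSum w K (pathSum (fun j => w (j + K)) L b) n := by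
  induction K generalizing w n with
  | zero => simp only [zero_add, add_zero, pathSum_zero]
  | succ K ih =>
    rw [show K + 1 + L = K + L + 1 by ring, pathSum_succ, pathSum_succ]
    refine tsum_congr fun m => ?_
    rw [ih]
    simp only [add_assoc]

/-- The sum over all altitude sequences factorizes along the path. -/
lemma tsum_path_eq (w : ℕ → ℕ → ℕ → ℝ≥0∞) (L : ℕ) (a b : ℕ → ℝ≥0∞) :
    ∑' γ : Fin (L + 1) → ℕ,
      a (γ 0) * (∏ j : Fin L, w j (γ j.castSucc) (γ j.succ)) * b (γ (Fin.last L)) =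
        ∑' n, a n * pathSum w L b n := by
  induction L generalizing w a with
  | zero =>
    rw [← (Equiv.funUnique (Fin 1) ℕ).symm.tsum_eq]
    refine tsum_congr fun n => ?_
    rw [pathSum_zero]
    simp
  | succ L ih =>
    rw [← (Fin.consEquiv fun _ => ℕ).tsum_eq, ENNReal.tsum_prod']
    refine tsum_congr fun n => ?_
    rw [pathSum_succ, ← ih (fun j => w (j + 1)) (w 0 n), ← ENNReal.tsum_mul_left]
    refine tsum_congr fun γ => ?_
    rw [Fin.prod_univ_succ]
    simp only [Fin.consEquiv, Equiv.coe_fn_mk, Fin.cons_zero, ← Fin.succ_last, Fin.cons_succ,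
      Fin.castSucc_zero, Fin.val_zero, Fin.val_succ, ← Fin.succ_castSucc]
    ring

/-- Without constraints the path sum is an iterate of the transfer operator. -/
lemma pathSum_stepWeight {σ : ℝ} (hσ : 0 ≤ σ) (M : ℕ) {g : ℕ → ℝ} (hg : 0 ≤ g) (n : ℕ) :
    pathSum (fun _ n m => ENNReal.ofReal (stepWeight σ n m)) M (fun k => ENNReal.ofReal (g k)) n =
      ENNReal.ofReal ((transfer σ ^ M) g n) := by
  induction M generalizing n with
  | zero => rw [pathSum_zero]; simp
  | succ M ih =>
    have hT := transfer_pow_nonneg hσ M hg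
    rw [pathSum_succ, transfer_pow_succ, ← (hasSum_stepWeight_mul σ _ n).tsum_eq,
      ENNReal.ofReal_tsum_of_nonneg (fun m => mul_nonneg (stepWeight_nonneg hσ n m) (hT m))
        (hasSum_stepWeight_mul σ _ n).summable]
    refine tsum_congr fun m => ?_
    rw [ih, ENNReal.ofReal_mul (stepWeight_nonneg hσ n m)]

/-- A path whose first `K` steps are prescribed. -/
lemma pathSum_prefix {σ : ℝ} (hσ : 0 ≤ σ) (x : ℕ → ℕ) {w : ℕ → ℕ → ℕ → ℝ≥0∞} (K : ℕ)
    (h : ∀ j < K, w j =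
      fun n m => if m = x (j + 1) then ENNReal.ofReal (stepWeight σ n m) else 0)
    (g : ℕ → ℝ≥0∞) :
    pathSum w K g (x 0) =
      ENNReal.ofReal (∏ j ∈ Finset.range K, stepWeight σ (x j) (x (j + 1))) * g (x K) := by
  induction K generalizing g with
  | zero => rw [pathSum_zero]; simp
  | succ K ih =>
    rw [pathSum_add, ih fun j hj => h j (by omega), pathSum_succ, zero_add, h K (by omega),
      Finset.prod_range_succ, ENNReal.ofReal_mul
        (Finset.prod_nonneg fun j _ => stepWeight_nonneg hσ _ _), mul_assoc]
    congr 1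
    rw [tsum_eq_single (x (K + 1)) fun m hm => by simp [hm], pathSum_zero]
    simp only [if_true]

/-- The weight of the path that starts at `n` and makes the steps `-e (k - 1), …, -e 0`, with end
point weight `ρ ^ ·`; it is `0` if this path becomes negative. -/
def tailWeight (σ ρ : ℝ) (e : ℕ → ℤ) : ℕ → ℕ → ℝ
  | 0, n => ρ ^ n
  | k + 1, n =>
    if 0 ≤ (n : ℤ) - e k then
      stepWeight σ n ((n : ℤ) - e k).toNat * tailWeight σ ρ e k ((n : ℤ) - e k).toNat
    else 0

lemma tailWeight_nonneg {σ ρ : ℝ} (hσ : 0 ≤ σ) (hρ : 0 ≤ ρ) (e : ℕ → ℤ) (k n : ℕ) :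
    0 ≤ tailWeight σ ρ e k n := by
  induction k generalizing n with
  | zero => exact pow_nonneg hρ n
  | succ k ih =>
    rw [tailWeight]
    split_ifs
    · exact mul_nonneg (stepWeight_nonneg hσ _ _) (ih _)
    · exact le_rfl

/-- A path whose last `k` steps are prescribed. -/
lemma pathSum_tail {σ ρ : ℝ} (hσ : 0 ≤ σ) (e : ℕ → ℤ)
    {w : ℕ → ℕ → ℕ → ℝ≥0∞} (k : ℕ)
    (h : ∀ j < k, w j = fun (n m : ℕ) =>
      if (n : ℤ) - m = e (k - 1 - j) then ENNReal.ofReal (stepWeight σ n m) else 0) (n : ℕ) :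
    pathSum w k (fun n => ENNReal.ofReal (ρ ^ n)) n = ENNReal.ofReal (tailWeight σ ρ e k n) := by
  induction k generalizing w n with
  | zero => rw [pathSum_zero, tailWeight]
  | succ k ih =>
    have hw : ∀ j < k, w (j + 1) = fun (n m : ℕ) =>
        if (n : ℤ) - m = e (k - 1 - j) then ENNReal.ofReal (stepWeight σ n m) else 0 := by
      intro j hj
      rw [h (j + 1) (by omega), show k + 1 - 1 - (j + 1) = k - 1 - j by omega]
    rw [pathSum_succ, h 0 (by omega), show k + 1 - 1 - 0 = k by omega, tailWeight]
    simp only [ih hw]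
    split_ifs with h0
    · rw [tsum_eq_single ((n : ℤ) - e k).toNat, if_pos (by omega),
        ENNReal.ofReal_mul (stepWeight_nonneg hσ _ _)]
      intro m hm
      rw [if_neg (by omega), zero_mul]
    · rw [ENNReal.ofReal_zero, ENNReal.tsum_eq_zero]
      intro m
      rw [if_neg (by omega), zero_mul]

lemma stepProb_nonneg {σ ρ : ℝ} (hσ : 0 < σ) (hρ : 0 < ρ) (e : ℤ) : 0 ≤ stepProb σ ρ e := by
  rw [stepProb]
  refine mul_nonneg (by positivity) ?_
  split_ifs <;> positivity

lemma stepWeight_mul_pow {σ ρ : ℝ} (hσ : 0 < σ) (hρ : 0 < ρ) (e : ℤ) (n : ℕ)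
    (h : 0 ≤ (n : ℤ) - e) :
    stepWeight σ n ((n : ℤ) - e).toNat * ρ ^ ((n : ℤ) - e).toNat =
      (ρ + 1 / ρ + σ) * stepProb σ ρ e * ρ ^ n := by
  have hl : ρ + 1 / ρ + σ ≠ 0 := by positivity
  rw [stepProb, ← mul_assoc, mul_one_div_cancel hl, one_mul]
  obtain ⟨m, hm⟩ : ∃ m : ℕ, (n : ℤ) - e = m := ⟨_, (Int.toNat_of_nonneg h).symm⟩
  rw [hm, Int.toNat_natCast, stepWeight]
  by_cases h1 : e = 1
  · obtain rfl : n = m + 1 := by omega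
    rw [if_neg (by omega), if_neg (by omega), if_pos rfl, if_pos h1, pow_succ]
    field_simp
  by_cases h2 : e = 0
  · obtain rfl : n = m := by omega
    rw [if_neg (by omega), if_pos rfl, if_neg h1, if_pos h2]
  by_cases h3 : e = -1
  · obtain rfl : m = n + 1 := by omega
    rw [if_pos rfl, if_neg h1, if_neg h2, if_pos h3, pow_succ]
    ring
  rw [if_neg (by omega), if_neg (by omega), if_neg (by omega), if_neg h1, if_neg h2, if_neg h3]
  ring

/-- The weight of the prescribed last steps is at most the weight of an unconstrained path. -/
lemma tailWeight_le {σ ρ : ℝ} (hσ : 0 < σ) (hρ : 0 < ρ) (e : ℕ → ℤ) (k n : ℕ) :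
    tailWeight σ ρ e k n ≤
      (∏ i ∈ Finset.range k, (ρ + 1 / ρ + σ) * stepProb σ ρ (e i)) * ρ ^ n := by
  have hl : 0 < ρ + 1 / ρ + σ := by positivity
  induction k generalizing n with
  | zero => simp [tailWeight]
  | succ k ih =>
    have hp : 0 ≤ ∏ i ∈ Finset.range k, (ρ + 1 / ρ + σ) * stepProb σ ρ (e i) :=
      Finset.prod_nonneg fun i _ => mul_nonneg hl.le (stepProb_nonneg hσ hρ _)
    rw [tailWeight, Finset.prod_range_succ]
    split_ifs with h
    · refine (mul_le_mul_of_nonneg_left (ih _) (stepWeight_nonneg hσ.le _ _)).trans (le_of_eq ?_)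
      rw [mul_left_comm, stepWeight_mul_pow hσ hρ _ _ h]; ring
    · exact mul_nonneg (mul_nonneg hp (mul_nonneg hl.le (stepProb_nonneg hσ hρ _)))
        (pow_pos hρ n).le

/-- Far from the boundary the prescribed last steps are those of a random walk. -/
lemma tailWeight_eq {σ ρ : ℝ} (hσ : 0 < σ) (hρ : 0 < ρ) (e : ℕ → ℤ) {k n : ℕ} (hkn : k ≤ n) :
    tailWeight σ ρ e k n =
      (∏ i ∈ Finset.range k, (ρ + 1 / ρ + σ) * stepProb σ ρ (e i)) * ρ ^ n := by
  induction k generalizing n with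
  | zero => simp [tailWeight]
  | succ k ih =>
    rw [tailWeight, Finset.prod_range_succ]
    by_cases h1 : e k ≤ 1
    · have h0 : 0 ≤ (n : ℤ) - e k := by omega
      rw [if_pos h0, ih (by omega), mul_left_comm, stepWeight_mul_pow hσ hρ _ _ h0]; ring
    · have hs : stepProb σ ρ (e k) = 0 := by
        rw [stepProb, if_neg (by omega), if_neg (by omega), if_neg (by omega), mul_zero]
      rw [hs]
      simp only [mul_zero, zero_mul]
      split_ifs with h0
      · rw [stepWeight, if_neg (by omega), if_neg (by omega), if_neg (by omega), zero_mul]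
      · rfl

namespace MotzkinPath

lemma weight_eq_prod (σ : ℝ) {L : ℕ} (γ : MotzkinPath L) :
    weight (fun _ => 1) (fun _ => σ) (fun _ => 1) γ =
      ∏ j : Fin L, stepWeight σ (γ.1 j.castSucc) (γ.1 j.succ) := by
  refine Finset.prod_congr rfl fun j _ => ?_
  have h := abs_le.1 (γ.2 j)
  rw [stepWeight]
  split_ifs <;> first | rfl | omega

lemma prod_stepWeight_eq_zero (σ : ℝ) {L : ℕ} {γ : Fin (L + 1) → ℕ}
    (h : ¬ ∀ j : Fin L, |(γ j.succ : ℤ) - (γ j.castSucc : ℤ)| ≤ 1) :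
    ∏ j : Fin L, ENNReal.ofReal (stepWeight σ (γ j.castSucc) (γ j.succ)) = 0 := by
  push Not at h
  obtain ⟨j, hj⟩ := h
  refine Finset.prod_eq_zero (Finset.mem_univ j) ?_
  have : ¬ |(γ j.succ : ℤ) - (γ j.castSucc : ℤ)| ≤ 1 := by omega
  rw [abs_le] at this
  rw [stepWeight, if_neg (by omega), if_neg (by omega), if_neg (by omega), ENNReal.ofReal_zero]

/-- The total weight of the paths that satisfy constraints on the initial altitude, on each single
step, and on the final altitude. -/
lemma tsum_indicator_fullWeight {σ ρ : ℝ} (hσ : 0 ≤ σ) {α : ℕ → ℝ}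
    (hα : ∀ n, 0 ≤ α n) {L : ℕ} (S : Set (MotzkinPath L)) (p q : ℕ → Prop)
    (c : ℕ → ℕ → ℕ → Prop) [DecidablePred p] [DecidablePred q] [∀ j n m, Decidable (c j n m)]
    (hS : ∀ γ : MotzkinPath L, γ ∈ S ↔
      p (γ.1 0) ∧ (∀ j : Fin L, c j (γ.1 j.castSucc) (γ.1 j.succ)) ∧ q (γ.1 (Fin.last L))) :
    ∑' γ : MotzkinPath L, S.indicator (fun γ => ENNReal.ofReal
      (fullWeight (fun _ => 1) (fun _ => σ) (fun _ => 1) α (fun n => ρ ^ n) γ)) γ =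
    ∑' n, (if p n then ENNReal.ofReal (α n) else 0) *
      pathSum (fun j n m => if c j n m then ENNReal.ofReal (stepWeight σ n m) else 0) L
        (fun n => if q n then ENNReal.ofReal (ρ ^ n) else 0) n := by
  rw [← tsum_path_eq]
  rw [← tsum_subtype_eq_of_support_subset
    (s := {γ : Fin (L + 1) → ℕ | ∀ j : Fin L, |(γ j.succ : ℤ) - (γ j.castSucc : ℤ)| ≤ 1})]
  · refine tsum_congr fun γ : MotzkinPath L => ?_
    rw [Finset.prod_ite_zero]
    by_cases h : γ ∈ S
    · obtain ⟨h1, h2, h3⟩ := (hS γ).1 h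
      rw [Set.indicator_of_mem h, if_pos h1, if_pos fun j _ => h2 j, if_pos h3, fullWeight,
        weight_eq_prod, ENNReal.ofReal_mul
          (mul_nonneg (hα _) (Finset.prod_nonneg fun j _ => stepWeight_nonneg hσ _ _)),
        ENNReal.ofReal_mul (hα _), ENNReal.ofReal_prod_of_nonneg
          fun j _ => stepWeight_nonneg hσ _ _]
    · rw [Set.indicator_of_notMem h]
      symm
      by_contra hne
      refine h ((hS γ).2 ⟨?_, ?_, ?_⟩)
      · by_contra h'; exact hne (by rw [if_neg h']; simp)
      · by_contra h'
        have h'' : ¬ ∀ j ∈ (Finset.univ : Finset (Fin L)), c j (γ.1 j.castSucc) (γ.1 j.succ) :=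
          fun hc => h' fun j => hc j (Finset.mem_univ j)
        exact hne (by rw [if_neg h'']; simp)
      · by_contra h'; exact hne (by rw [if_neg h']; simp)
  · intro γ hγ
    by_contra h
    refine hγ ?_
    simp only [Finset.prod_ite_zero]
    rw [prod_stepWeight_eq_zero σ h]
    simp

lemma law_apply (a b c α β : ℕ → ℝ) (L : ℕ) (S : Set (MotzkinPath L)) :
    law a b c α β L S =
      (∑' γ : MotzkinPath L, S.indicator (fun γ => ENNReal.ofReal (fullWeight a b c α β γ)) γ) /
        normConst a b c α β L := by
  rw [law, Measure.sum_apply _ (MeasurableSpace.measurableSet_top), ENNReal.div_eq_inv_mul,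
    ← ENNReal.tsum_mul_left]
  refine tsum_congr fun γ => ?_
  rw [Measure.smul_apply, Measure.dirac_apply' _ MeasurableSpace.measurableSet_top, smul_eq_mul]
  by_cases h : γ ∈ S
  · simp [h, ENNReal.div_eq_inv_mul]
  · simp [h]

end MotzkinPath

/-! ### Asymptotics of the total weights -/

/-- Prescribing the last `k` steps multiplies the number of long paths by the weight of these
steps under the random walk. -/
lemma tendsto_transfer_pow_tailWeight_div {σ ρ : ℝ} (hσ : 0 < σ) (hρ : 1 ≤ ρ) (e : ℕ → ℤ)
    (k n : ℕ) :
    Tendsto (fun M => (transfer σ ^ M) (tailWeight σ ρ e k) n / expSum σ ρ M 0) atTop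
      (𝓝 ((∏ i ∈ Finset.range k, (ρ + 1 / ρ + σ) * stepProb σ ρ (e i)) * chebRatio ρ n)) := by
  have hρ0 : 0 < ρ := by linarith
  set c := ∏ i ∈ Finset.range k, (ρ + 1 / ρ + σ) * stepProb σ ρ (e i) with hc
  have hc0 : 0 ≤ c := Finset.prod_nonneg fun i _ =>
    mul_nonneg (by positivity) (stepProb_nonneg hσ hρ0 _)
  have hup (M : ℕ) : (transfer σ ^ M) (tailWeight σ ρ e k) n ≤ c * expSum σ ρ M n := by
    have h := transfer_pow_mono hσ.le M (h := c • fun n => ρ ^ n) (tailWeight_le hσ hρ0 e k) n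
    rwa [map_smul] at h
  have hlow (M : ℕ) : c * (expSum σ ρ M n -
      ∑ y ∈ Finset.range k, ρ ^ y * (transfer σ ^ M) (Pi.single y 1) n) ≤
        (transfer σ ^ M) (tailWeight σ ρ e k) n := by
    have h : c • ((fun n => ρ ^ n) - ∑ y ∈ Finset.range k, ρ ^ y • (Pi.single y 1 : ℕ → ℝ)) ≤
        tailWeight σ ρ e k := by
      intro m
      simp only [Pi.smul_apply, Pi.sub_apply, Finset.sum_apply, smul_eq_mul]
      by_cases hm : m < k
      · have : ∑ y ∈ Finset.range k, ρ ^ y * (Pi.single y 1 : ℕ → ℝ) m = ρ ^ m := by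
          rw [Finset.sum_eq_single m]
          · simp
          · intro y _ hy; simp [hy.symm]
          · simp [hm]
        rw [this, sub_self, mul_zero]
        exact tailWeight_nonneg hσ.le hρ0.le e k m
      · have : ∑ y ∈ Finset.range k, ρ ^ y * (Pi.single y 1 : ℕ → ℝ) m = 0 := by
          refine Finset.sum_eq_zero fun y hy => ?_
          have : m ≠ y := by have := Finset.mem_range.1 hy; omega
          simp [this]
        rw [this, sub_zero, tailWeight_eq hσ hρ0 e (by omega)]
    have h' := transfer_pow_mono hσ.le M h n
    rw [map_smul, map_sub, map_sum] at h'
    simpa [expSum] using h'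
  have h1 := (tendsto_expSum_div hσ hρ n).const_mul c
  have h2 : Tendsto (fun M => ∑ y ∈ Finset.range k,
      ρ ^ y * ((transfer σ ^ M) (Pi.single y 1) n / expSum σ ρ M 0)) atTop (𝓝 0) := by
    have := tendsto_finsetSum (Finset.range k) fun y _ =>
      (tendsto_transfer_pow_single_div hσ hρ n y).const_mul (ρ ^ y)
    simpa using this
  have h3 := ((tendsto_expSum_div hσ hρ n).sub h2).const_mul c
  rw [sub_zero] at h3
  refine tendsto_of_tendsto_of_tendsto_of_le_of_le h3 h1 (fun M => ?_) (fun M => ?_)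
  · have s := expSum_pos hσ hρ0 M 0
    simp only
    rw [le_div_iff₀ s]
    refine le_trans (le_of_eq ?_) (hlow M)
    rw [mul_assoc, sub_mul, div_mul_cancel₀ _ s.ne', Finset.sum_mul]
    congr 2
    refine Finset.sum_congr rfl fun y _ => ?_
    rw [mul_assoc, div_mul_cancel₀ _ s.ne']
  · have s := expSum_pos hσ hρ0 M 0
    simp only
    rw [mul_div_assoc']
    exact div_le_div_of_nonneg_right (hup M) s.le

/-- The real normalizing constant. -/
def totalWeight (σ ρ : ℝ) (α : ℕ → ℝ) (L : ℕ) : ℝ := ∑' n, α n * expSum σ ρ L n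

lemma summable_bound {ρ : ℝ} (hρ : 1 ≤ ρ) {α : ℕ → ℝ} (hα : ∀ n, 0 ≤ α n)
    (hsum : Summable fun m : ℕ => (m : ℝ) * α m * ρ ^ m) :
    Summable fun n : ℕ => α n * (((n : ℝ) + 1) * ρ ^ n) := by
  rw [← summable_nat_add_iff 1]
  refine Summable.of_nonneg_of_le (fun n => ?_) (fun n => ?_)
    (((summable_nat_add_iff 1).2 hsum).mul_left 2)
  · exact mul_nonneg (hα _) (by positivity)
  · have h : 0 ≤ α (n + 1) * ρ ^ (n + 1) := mul_nonneg (hα _) (by positivity)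
    have hn : (0 : ℝ) ≤ n := n.cast_nonneg
    push_cast
    nlinarith [mul_nonneg hn h]

lemma summable_mul_of_le {ρ : ℝ} (hρ : 1 ≤ ρ) {α : ℕ → ℝ} (hα : ∀ n, 0 ≤ α n)
    (hsum : Summable fun m : ℕ => (m : ℝ) * α m * ρ ^ m) {g : ℕ → ℝ} (hg : ∀ n, 0 ≤ g n) {C : ℝ}
    (hgC : ∀ n, g n ≤ ((n : ℝ) + 1) * ρ ^ n * C) : Summable fun n => α n * g n := by
  refine Summable.of_nonneg_of_le (fun n => mul_nonneg (hα n) (hg n)) (fun n => ?_)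
    ((summable_bound hρ hα hsum).mul_right C)
  rw [mul_assoc]
  exact mul_le_mul_of_nonneg_left (hgC n) (hα n)

lemma summable_totalWeight {σ ρ : ℝ} (hσ : 0 < σ) (hρ : 1 ≤ ρ) {α : ℕ → ℝ} (hα : ∀ n, 0 ≤ α n)
    (hsum : Summable fun m : ℕ => (m : ℝ) * α m * ρ ^ m) (L : ℕ) :
    Summable fun n => α n * expSum σ ρ L n :=
  summable_mul_of_le hρ hα hsum (fun n => (expSum_pos hσ (by linarith) L n).le)
    (fun n => expSum_le hσ hρ L n)

lemma summable_mul_chebRatio {ρ : ℝ} (hρ : 1 ≤ ρ) {α : ℕ → ℝ} (hα : ∀ n, 0 ≤ α n)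
    (hsum : Summable fun m : ℕ => (m : ℝ) * α m * ρ ^ m) :
    Summable fun n => α n * chebRatio ρ n :=
  summable_mul_of_le hρ hα hsum (C := 1) (fun n => (chebRatio_pos hρ n).le)
    (fun n => by rw [mul_one]; exact chebRatio_le hρ n)

lemma totalWeight_pos {σ ρ : ℝ} (hσ : 0 < σ) (hρ : 1 ≤ ρ) {α : ℕ → ℝ} (hα : ∀ n, 0 ≤ α n)
    (hα0 : ∃ n, α n ≠ 0) (hsum : Summable fun m : ℕ => (m : ℝ) * α m * ρ ^ m) (L : ℕ) :
    0 < totalWeight σ ρ α L := by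
  obtain ⟨n, hn⟩ := hα0
  have hpos (n : ℕ) := expSum_pos hσ (show 0 < ρ by linarith) L n
  exact (summable_totalWeight hσ hρ hα hsum L).tsum_pos (fun n => mul_nonneg (hα n) (hpos n).le) n
    (mul_pos ((hα n).lt_of_ne' hn) (hpos n))

lemma tsum_mul_chebRatio_pos {ρ : ℝ} (hρ : 1 ≤ ρ) {α : ℕ → ℝ} (hα : ∀ n, 0 ≤ α n)
    (hα0 : ∃ n, α n ≠ 0) (hsum : Summable fun m : ℕ => (m : ℝ) * α m * ρ ^ m) :
    0 < ∑' n, α n * chebRatio ρ n := by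
  obtain ⟨n, hn⟩ := hα0
  exact (summable_mul_chebRatio hρ hα hsum).tsum_pos
    (fun n => mul_nonneg (hα n) (chebRatio_pos hρ n).le) n
    (mul_pos ((hα n).lt_of_ne' hn) (chebRatio_pos hρ n))

lemma tendsto_totalWeight_div {σ ρ : ℝ} (hσ : 0 < σ) (hρ : 1 ≤ ρ) {α : ℕ → ℝ}
    (hα : ∀ n, 0 ≤ α n) (hsum : Summable fun m : ℕ => (m : ℝ) * α m * ρ ^ m) :
    Tendsto (fun L => totalWeight σ ρ α L / expSum σ ρ L 0) atTop
      (𝓝 (∑' n, α n * chebRatio ρ n)) := by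
  have h := tendsto_tsum_of_dominated_convergence (𝓕 := atTop)
    (f := fun L n => α n * (expSum σ ρ L n / expSum σ ρ L 0)) (summable_bound hρ hα hsum)
    (fun n => (tendsto_expSum_div hσ hρ n).const_mul (α n)) (.of_forall fun L n => ?_)
  · refine h.congr fun L => ?_
    rw [totalWeight, ← tsum_div_const]
    exact tsum_congr fun n => by ring
  · have s (n : ℕ) := expSum_pos hσ (show 0 < ρ by linarith) L n
    rw [Real.norm_of_nonneg (mul_nonneg (hα n) (div_pos (s n) (s 0)).le)]
    refine mul_le_mul_of_nonneg_left ?_ (hα n)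
    rw [div_le_iff₀ (s 0)]
    exact expSum_le hσ hρ L n

/-- The total weight of the paths that end at a fixed altitude is negligible. -/
lemma tendsto_endWeight_div {σ ρ : ℝ} (hσ : 0 < σ) (hρ : 1 ≤ ρ) {α : ℕ → ℝ}
    (hα : ∀ n, 0 ≤ α n) (hsum : Summable fun m : ℕ => (m : ℝ) * α m * ρ ^ m) (y : ℕ) :
    Tendsto (fun L => (∑' n, α n * (transfer σ ^ L) (Pi.single y 1) n) / expSum σ ρ L 0) atTop
      (𝓝 0) := by
  have h := tendsto_tsum_of_dominated_convergence (𝓕 := atTop)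
    (f := fun L n => α n * ((transfer σ ^ L) (Pi.single y 1) n / expSum σ ρ L 0))
    (summable_bound hρ hα hsum)
    (fun n => (tendsto_transfer_pow_single_div hσ hρ n y).const_mul (α n))
    (.of_forall fun L n => ?_)
  · simp only [mul_zero, tsum_zero] at h
    refine h.congr fun L => ?_
    rw [← tsum_div_const]
    exact tsum_congr fun n => by ring
  · have s (n : ℕ) := expSum_pos hσ (show 0 < ρ by linarith) L n
    have hn := transfer_pow_nonneg hσ.le L (single_nonneg y) n
    rw [Real.norm_of_nonneg (mul_nonneg (hα n) (div_nonneg hn (s 0).le))]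
    refine mul_le_mul_of_nonneg_left ?_ (hα n)
    rw [div_le_iff₀ (s 0)]
    refine le_trans ?_ (expSum_le hσ hρ L n)
    refine transfer_pow_mono hσ.le L (fun k => ?_) n
    by_cases hk : k = y
    · subst hk; simpa using one_le_pow₀ hρ
    · simpa [hk] using pow_nonneg (show 0 ≤ ρ by linarith) k

/-! ### The law of the random path -/

namespace MotzkinPath

lemma normConst_eq {σ ρ : ℝ} (hσ : 0 < σ) (hρ : 1 ≤ ρ) {α : ℕ → ℝ} (hα : ∀ n, 0 ≤ α n)
    (hsum : Summable fun m : ℕ => (m : ℝ) * α m * ρ ^ m) (L : ℕ) :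
    normConst (fun _ => 1) (fun _ => σ) (fun _ => 1) α (fun n => ρ ^ n) L =
      ENNReal.ofReal (totalWeight σ ρ α L) := by
  have h := tsum_indicator_fullWeight (ρ := ρ) hσ.le hα (L := L) Set.univ (fun _ => True)
    (fun _ => True) (fun _ _ _ => True) (fun γ => by simp)
  simp only [Set.indicator_univ, if_true] at h
  have hpos (n : ℕ) := expSum_pos hσ (show 0 < ρ by linarith) L n
  rw [normConst, h, totalWeight, ENNReal.ofReal_tsum_of_nonneg
    (fun n => mul_nonneg (hα n) (hpos n).le) (summable_totalWeight hσ hρ hα hsum L)]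
  refine tsum_congr fun n => ?_
  rw [ENNReal.ofReal_mul (hα n), expSum, ← pathSum_stepWeight hσ.le]
  intro k
  exact pow_nonneg (by linarith) k

lemma isProbabilityMeasure_law {σ ρ : ℝ} (hσ : 0 < σ) (hρ : 1 ≤ ρ) {α : ℕ → ℝ}
    (hα : ∀ n, 0 ≤ α n) (hα0 : ∃ n, α n ≠ 0)
    (hsum : Summable fun m : ℕ => (m : ℝ) * α m * ρ ^ m) (L : ℕ) :
    IsProbabilityMeasure
      (law (fun _ => 1) (fun _ => σ) (fun _ => 1) α (fun n => ρ ^ n) L) where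
  measure_univ := by
    rw [law_apply, Set.indicator_univ, ← normConst, normConst_eq hσ hρ hα hsum]
    exact ENNReal.div_self (by simpa using totalWeight_pos hσ hρ hα hα0 hsum L)
      ENNReal.ofReal_ne_top

lemma law_rightEnd {σ ρ : ℝ} (hσ : 0 < σ) (hρ : 1 ≤ ρ) {α : ℕ → ℝ}
    (hα : ∀ n, 0 ≤ α n) (hα0 : ∃ n, α n ≠ 0)
    (hsum : Summable fun m : ℕ => (m : ℝ) * α m * ρ ^ m) (L y : ℕ) :
    law (fun _ => 1) (fun _ => σ) (fun _ => 1) α (fun n => ρ ^ n) L {γ | γ.rightEnd = y} =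
      ENNReal.ofReal ((ρ ^ y * ∑' n, α n * (transfer σ ^ L) (Pi.single y 1) n) /
        totalWeight σ ρ α L) := by
  have hρ0 : 0 < ρ := by linarith
  have hnn (n : ℕ) := transfer_pow_nonneg hσ.le L (single_nonneg y) n
  have h := tsum_indicator_fullWeight (ρ := ρ) hσ.le hα (L := L) {γ | γ.rightEnd = y}
    (fun _ => True) (fun n => n = y) (fun _ _ _ => True) (fun γ => by simp [rightEnd])
  simp only [if_true] at h
  have hb : (fun n => if n = y then ENNReal.ofReal (ρ ^ n) else 0) =
      fun n => ENNReal.ofReal ((ρ ^ y • (Pi.single y 1 : ℕ → ℝ)) n) := by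
    funext n
    split_ifs with hn
    · subst hn; simp
    · simp [hn]
  have hs : Summable fun n => α n * (ρ ^ y * (transfer σ ^ L) (Pi.single y 1) n) := by
    refine Summable.of_nonneg_of_le
      (fun n => mul_nonneg (hα n) (mul_nonneg (by positivity) (hnn n))) (fun n => ?_)
      (summable_totalWeight hσ hρ hα hsum L)
    refine mul_le_mul_of_nonneg_left ?_ (hα n)
    have h2 : ρ ^ y • (Pi.single y 1 : ℕ → ℝ) ≤ fun k => ρ ^ k := by
      intro k
      by_cases hk : k = y
      · subst hk; simp
      · simpa [hk] using pow_nonneg hρ0.le k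
    have h3 := transfer_pow_mono hσ.le L h2 n
    rwa [map_smul] at h3
  rw [law_apply, h, normConst_eq hσ hρ hα hsum,
    ENNReal.ofReal_div_of_pos (totalWeight_pos hσ hρ hα hα0 hsum L), ← tsum_mul_left,
    tsum_congr fun n => mul_left_comm (ρ ^ y) (α n) _, ENNReal.ofReal_tsum_of_nonneg
      (fun n => mul_nonneg (hα n) (mul_nonneg (by positivity) (hnn n))) hs]
  congr 1
  refine tsum_congr fun n => ?_
  rw [hb, pathSum_stepWeight hσ.le, ENNReal.ofReal_mul (hα n), map_smul]
  · rfl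
  · intro k
    exact mul_nonneg (by positivity) (single_nonneg y k)

lemma tendsto_law_rightEnd {σ ρ : ℝ} (hσ : 0 < σ) (hρ : 1 ≤ ρ) {α : ℕ → ℝ}
    (hα : ∀ n, 0 ≤ α n) (hα0 : ∃ n, α n ≠ 0)
    (hsum : Summable fun m : ℕ => (m : ℝ) * α m * ρ ^ m) (y : ℕ) :
    Tendsto (fun L => law (fun _ => 1) (fun _ => σ) (fun _ => 1) α (fun n => ρ ^ n) L
      {γ | γ.rightEnd = y}) atTop (𝓝 0) := by
  simp only [law_rightEnd hσ hρ hα hα0 hsum]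
  rw [← ENNReal.ofReal_zero]
  refine (ENNReal.continuous_ofReal.tendsto 0).comp ?_
  have h := ((tendsto_endWeight_div hσ hρ hα hsum y).const_mul (ρ ^ y)).div
    (tendsto_totalWeight_div hσ hρ hα hsum) (tsum_mul_chebRatio_pos hρ hα hα0 hsum).ne'
  rw [mul_zero, zero_div] at h
  refine h.congr fun L => ?_
  have s := (expSum_pos hσ (show 0 < ρ by linarith) L 0).ne'
  simp only [Pi.div_apply]
  rw [mul_div_assoc', div_div_div_cancel_right₀ s]

/-- The right end point escapes to infinity, so its laws are not tight. -/
lemma not_isTight_rightEnd {σ ρ : ℝ} (hσ : 0 < σ) (hρ : 1 ≤ ρ) {α : ℕ → ℝ}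
    (hα : ∀ n, 0 ≤ α n) (hα0 : ∃ n, α n ≠ 0)
    (hsum : Summable fun m : ℕ => (m : ℝ) * α m * ρ ^ m) :
    ¬ IsTightMeasureSet {μ : Measure ℕ | ∃ L, 1 ≤ L ∧
      μ = (law (fun _ => 1) (fun _ => σ) (fun _ => 1) α (fun n => ρ ^ n) L).map rightEnd} := by
  rw [isTightMeasureSet_iff_exists_isCompact_measure_compl_le]
  intro h
  obtain ⟨K, hK, hμ⟩ := h 2⁻¹ (by simp)
  have hfin := hK.finite_of_discrete
  have hlim : Tendsto (fun L => ∑ y ∈ hfin.toFinset,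
      law (fun _ => 1) (fun _ => σ) (fun _ => 1) α (fun n => ρ ^ n) L {γ | γ.rightEnd = y})
      atTop (𝓝 0) := by
    simpa using tendsto_finsetSum hfin.toFinset fun y _ =>
      tendsto_law_rightEnd hσ hρ hα hα0 hsum y
  obtain ⟨L, hL1, hL⟩ := ((eventually_ge_atTop 1).and
    (hlim.eventually_lt_const (show (0 : ℝ≥0∞) < 2⁻¹ by simp))).exists
  have := isProbabilityMeasure_law hσ hρ hα hα0 hsum L
  have hm : Measurable (rightEnd : MotzkinPath L → ℕ) := measurable_from_top
  have h1 := hμ _ ⟨L, hL1, rfl⟩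
  have h2 : (law (fun _ => 1) (fun _ => σ) (fun _ => 1) α (fun n => ρ ^ n) L).map rightEnd K
      < 2⁻¹ := by
    refine lt_of_le_of_lt ?_ hL
    rw [Measure.map_apply hm .of_discrete]
    refine le_trans (measure_mono fun γ hγ => ?_) (measure_biUnion_finset_le _ _)
    exact Set.mem_biUnion (hfin.mem_toFinset.2 hγ) rfl
  have := Measure.isProbabilityMeasure_map (μ := law (fun _ => 1) (fun _ => σ) (fun _ => 1) α
    (fun n => ρ ^ n) L) hm.aemeasurable
  have h3 := prob_add_prob_compl (μ := (law (fun _ => 1) (fun _ => σ) (fun _ => 1) α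
    (fun n => ρ ^ n) L).map rightEnd) (s := K) .of_discrete
  have h4 := ENNReal.add_lt_add_of_lt_of_le (measure_ne_top _ _) h2 h1
  rw [h3, ENNReal.inv_two_add_inv_two] at h4
  exact lt_irrefl _ h4

/-- The event that the first altitudes and the last steps are prescribed. -/
def boundaryEvent (L K : ℕ) (x : ℕ → ℕ) (e : ℕ → ℤ) : Set (MotzkinPath L) :=
  {γ | (∀ j ≤ K, γ.left j = x j) ∧ ∀ j < K, γ.reversedStep j = e j}

/-- When the first and last `K` steps do not overlap, the event constrains each step separately:
the reversed step `k` is the step `L - 1 - k` of the path, read backwards. -/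
lemma mem_boundaryEvent_iff {L K M : ℕ} (hL : L = K + (M + K)) (x : ℕ → ℕ) (e : ℕ → ℤ)
    (γ : MotzkinPath L) :
    γ ∈ boundaryEvent L K x e ↔ γ.1 0 = x 0 ∧
      (∀ j : Fin L, ((j : ℕ) < K → γ.1 j.succ = x (j + 1)) ∧
        (L - 1 - j < K → (γ.1 j.castSucc : ℤ) - γ.1 j.succ = e (L - 1 - j))) ∧ True := by
  have hrev (j : Fin L) : γ.reversedStep (L - 1 - j) =
      (γ.1 j.castSucc : ℤ) - γ.1 j.succ := by
    have hj := j.2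
    rw [reversedStep, reversed, reversed, if_pos (by omega), if_pos (by omega), left, left,
      dif_pos (by omega), dif_pos (by omega)]
    have e1 : (⟨L - (L - 1 - j + 1), by omega⟩ : Fin (L + 1)) = j.castSucc := by
      ext; simp; omega
    have e2 : (⟨L - (L - 1 - j), by omega⟩ : Fin (L + 1)) = j.succ := by
      ext; simp; omega
    rw [e1, e2]; ring
  have hleft (j : Fin L) : γ.left (j + 1) = γ.1 j.succ := by
    have hj := j.2
    rw [left, dif_pos (by omega)]; rfl
  have hleft0 : γ.left 0 = γ.1 0 := by
    rw [left, dif_pos (by omega)]; rfl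
  constructor
  · rintro ⟨h1, h2⟩
    refine ⟨by rw [← hleft0, h1 0 (by omega)], fun j => ⟨fun hj => ?_, fun hj => ?_⟩, trivial⟩
    · rw [← hleft, h1 _ (by omega)]
    · rw [← hrev, h2 _ hj]
  · rintro ⟨h0, h, -⟩
    refine ⟨fun j hj => ?_, fun j hj => ?_⟩
    · rcases j with _ | j
      · rw [hleft0, h0]
      · have := (h ⟨j, by omega⟩).1 (by simpa using hj)
        rw [← hleft] at this
        exact this
    · have h3 := (h ⟨L - 1 - j, by omega⟩).2 (by simp; omega)
      rw [← hrev] at h3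
      have e1 : L - 1 - (L - 1 - j) = j := by omega
      simpa only [e1] using h3

/-- The probability of prescribing the first and last `K` steps, with `M` free steps between. -/
lemma law_boundaryEvent {σ ρ : ℝ} (hσ : 0 < σ) (hρ : 1 ≤ ρ) {α : ℕ → ℝ}
    (hα : ∀ n, 0 ≤ α n) (hα0 : ∃ n, α n ≠ 0)
    (hsum : Summable fun m : ℕ => (m : ℝ) * α m * ρ ^ m) {L K M : ℕ} (hL : L = K + (M + K))
    (x : ℕ → ℕ) (e : ℕ → ℤ) :
    (law (fun _ => 1) (fun _ => σ) (fun _ => 1) α (fun n => ρ ^ n) L).real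
        (boundaryEvent L K x e) =
      α (x 0) * (∏ j ∈ Finset.range K, stepWeight σ (x j) (x (j + 1))) *
        (transfer σ ^ M) (tailWeight σ ρ e K) (x K) / totalWeight σ ρ α L := by
  have hρ0 : 0 < ρ := by linarith
  have ht := transfer_pow_nonneg hσ.le M (fun n => tailWeight_nonneg hσ.le hρ0.le e K n) (x K)
  have hw : 0 ≤ ∏ j ∈ Finset.range K, stepWeight σ (x j) (x (j + 1)) :=
    Finset.prod_nonneg fun j _ => stepWeight_nonneg hσ.le _ _
  have h := tsum_indicator_fullWeight (ρ := ρ) hσ.le hα (L := L) (boundaryEvent L K x e)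
    (fun n => n = x 0) (fun _ => True)
    (fun j n m => (j < K → m = x (j + 1)) ∧ (L - 1 - j < K → (n : ℤ) - m = e (L - 1 - j)))
    (mem_boundaryEvent_iff hL x e)
  have hpath : pathSum (fun j n m => if (j < K → m = x (j + 1)) ∧
        (L - 1 - j < K → (n : ℤ) - m = e (L - 1 - j)) then ENNReal.ofReal (stepWeight σ n m) else 0)
        L (fun n => ENNReal.ofReal (ρ ^ n)) (x 0) =
      ENNReal.ofReal (∏ j ∈ Finset.range K, stepWeight σ (x j) (x (j + 1))) *
        ENNReal.ofReal ((transfer σ ^ M) (tailWeight σ ρ e K) (x K)) := by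
    subst hL
    rw [pathSum_add, pathSum_prefix hσ.le x K]
    · congr 1
      rw [← pathSum_stepWeight hσ.le M (fun n => tailWeight_nonneg hσ.le hρ0.le e K n), pathSum_add]
      have htail : pathSum (fun j n m => if (j + M + K < K → m = x (j + M + K + 1)) ∧
          (K + (M + K) - 1 - (j + M + K) < K →
            (n : ℤ) - m = e (K + (M + K) - 1 - (j + M + K))) then
          ENNReal.ofReal (stepWeight σ n m) else 0) K (fun n => ENNReal.ofReal (ρ ^ n)) =
          fun n => ENNReal.ofReal (tailWeight σ ρ e K n) := by
        funext n
        refine pathSum_tail hσ.le e K (fun j hj => ?_) n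
        funext n m
        rw [show K + (M + K) - 1 - (j + M + K) = K - 1 - j by omega]
        refine if_congr ?_ rfl rfl
        exact ⟨fun h => h.2 (by omega), fun h => ⟨fun h' => by omega, fun _ => h⟩⟩
      rw [htail]
      refine pathSum_congr (fun j hj => ?_) _ _
      funext n m
      exact if_pos ⟨fun h' => by omega, fun h' => by omega⟩
    · intro j hj
      funext n m
      refine if_congr ?_ rfl rfl
      exact ⟨fun h => h.1 hj, fun h => ⟨fun _ => h, fun h' => by omega⟩⟩
  rw [Measure.real, law_apply, h, normConst_eq hσ hρ hα hsum,
    tsum_eq_single (x 0) fun n hn => by simp [hn]]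
  simp only [if_true]
  rw [hpath, ← mul_assoc, ← ENNReal.ofReal_mul (hα _),
    ← ENNReal.ofReal_mul (mul_nonneg (hα _) hw),
    ← ENNReal.ofReal_div_of_pos (totalWeight_pos hσ hρ hα hα0 hsum L), ENNReal.toReal_ofReal]
  exact div_nonneg (mul_nonneg (mul_nonneg (hα _) hw) ht)
    (totalWeight_pos hσ hρ hα hα0 hsum L).le

lemma limitKernel_eq {σ ρ : ℝ} (hρ : 1 ≤ ρ) (n m : ℕ) :
    limitKernel σ ρ n m =
      1 / (ρ + 1 / ρ + σ) * (stepWeight σ n m * (chebRatio ρ m / chebRatio ρ n)) := by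
  rw [limitKernel, stepWeight]
  split_ifs with h1 h2 h3
  · rw [h1, one_mul]
  · rw [h2, div_self (chebRatio_pos hρ n).ne', mul_one]
  · rw [one_mul]
  · ring

/-- The transition probabilities are a Doob transform, so their product telescopes. -/
lemma prod_limitKernel {σ ρ : ℝ} (hρ : 1 ≤ ρ) (x : ℕ → ℕ) (K : ℕ) :
    chebRatio ρ (x 0) * ∏ j ∈ Finset.range K, limitKernel σ ρ (x j) (x (j + 1)) =
      (1 / (ρ + 1 / ρ + σ)) ^ K * (∏ j ∈ Finset.range K, stepWeight σ (x j) (x (j + 1))) *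
        chebRatio ρ (x K) := by
  induction K with
  | zero => simp
  | succ K ih =>
    rw [Finset.prod_range_succ, ← mul_assoc, ih, limitKernel_eq hρ, Finset.prod_range_succ]
    have := (chebRatio_pos hρ (x K)).ne'
    generalize 1 / (ρ + 1 / ρ + σ) = c
    field_simp
    ring

/-- Convergence of the probabilities of all events that prescribe the first altitudes and the last
steps. -/
lemma tendsto_law_boundaryEvent {σ ρ : ℝ} (hσ : 0 < σ) (hρ : 1 ≤ ρ) {α : ℕ → ℝ}
    (hα : ∀ n, 0 ≤ α n) (hα0 : ∃ n, α n ≠ 0)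
    (hsum : Summable fun m : ℕ => (m : ℝ) * α m * ρ ^ m) (K : ℕ) (x : ℕ → ℕ) (e : ℕ → ℤ) :
    Tendsto (fun L => (law (fun _ => 1) (fun _ => σ) (fun _ => 1) α (fun n => ρ ^ n) L).real
        (boundaryEvent L K x e)) atTop
      (𝓝 ((limitInit α ρ (x 0) * ∏ j ∈ Finset.range K, limitKernel σ ρ (x j) (x (j + 1))) *
        ∏ i ∈ Finset.range K, stepProb σ ρ (e i))) := by
  have hρ0 : 0 < ρ := by linarith
  have hl : 0 < ρ + 1 / ρ + σ := by positivity
  have hA := tsum_mul_chebRatio_pos hρ hα hα0 hsum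
  rw [← tendsto_add_atTop_iff_nat (K + K)]
  have hZ : Tendsto (fun M => totalWeight σ ρ α (M + (K + K)) / expSum σ ρ M 0) atTop
      (𝓝 ((∑' n, α n * chebRatio ρ n) * (ρ + 1 / ρ + σ) ^ (K + K))) := by
    refine (((tendsto_totalWeight_div hσ hρ hα hsum).comp (tendsto_add_atTop_nat (K + K))).mul
      (tendsto_expSum_add_div hσ hρ (K + K))).congr fun M => ?_
    exact div_mul_div_cancel₀ (expSum_pos hσ hρ0 _ 0).ne'
  have h := ((tendsto_transfer_pow_tailWeight_div hσ hρ e K (x K)).const_mul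
    (α (x 0) * (∏ j ∈ Finset.range K, stepWeight σ (x j) (x (j + 1))))).div hZ (by positivity)
  convert h using 1
  · funext M
    rw [law_boundaryEvent hσ hρ hα hα0 hsum (show M + (K + K) = K + (M + K) by ring)]
    have s := (expSum_pos hσ hρ0 M 0).ne'
    simp only [Pi.div_apply]
    rw [mul_div_assoc', div_div_div_cancel_right₀ s]
  · congr 1
    have hp := prod_limitKernel (σ := σ) hρ x K
    rw [limitInit, Finset.prod_mul_distrib, Finset.prod_const, Finset.card_range,
      div_mul_eq_mul_div, mul_assoc (α (x 0)), hp, one_div, inv_pow, pow_add]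
    field_simp

end MotzkinPath

/-! ### Existence of the limiting pair -/

lemma hasSum_stepProb {σ ρ : ℝ} (hσ : 0 < σ) (hρ : 0 < ρ) : HasSum (stepProb σ ρ) 1 := by
  have hl : ρ + 1 / ρ + σ ≠ 0 := by positivity
  have h := hasSum_sum_of_ne_finset_zero (L := .unconditional ℤ) (f := stepProb σ ρ)
    (s := {1, 0, -1}) (fun m hm => by
      simp only [Finset.mem_insert, Finset.mem_singleton, not_or] at hm
      simp [stepProb, hm.1, hm.2.1, hm.2.2])
  convert h using 1
  rw [Finset.sum_insert (by simp), Finset.sum_pair (by simp)]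
  simp only [stepProb]
  rw [← mul_add, ← mul_add]
  norm_num
  field_simp
  ring

lemma limitKernel_nonneg {σ ρ : ℝ} (hσ : 0 < σ) (hρ : 1 ≤ ρ) (n m : ℕ) :
    0 ≤ limitKernel σ ρ n m := by
  have hρ0 : 0 < ρ := by linarith
  rw [MotzkinPath.limitKernel_eq hρ]
  exact mul_nonneg (by positivity) (mul_nonneg (stepWeight_nonneg hσ.le n m)
    (div_pos (chebRatio_pos hρ m) (chebRatio_pos hρ n)).le)

/-- The transition probabilities sum to one because `chebRatio ρ` is harmonic. -/
lemma hasSum_limitKernel {σ ρ : ℝ} (hσ : 0 < σ) (hρ : 1 ≤ ρ) (n : ℕ) :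
    HasSum (limitKernel σ ρ n) 1 := by
  have hρ0 : 0 < ρ := by linarith
  have hl : ρ + 1 / ρ + σ ≠ 0 := by positivity
  have hu := (chebRatio_pos hρ n).ne'
  have h := (hasSum_stepWeight_mul σ (chebRatio ρ) n).mul_left
    (1 / (ρ + 1 / ρ + σ) / chebRatio ρ n)
  rw [transfer_chebRatio σ hρ, div_mul_eq_mul_div, ← mul_assoc, one_div_mul_cancel hl, one_mul,
    div_self hu] at h
  have e : limitKernel σ ρ n =
      fun m => 1 / (ρ + 1 / ρ + σ) / chebRatio ρ n * (stepWeight σ n m * chebRatio ρ m) :=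
    funext fun m => by rw [MotzkinPath.limitKernel_eq hρ]; ring
  rwa [e]

lemma hasSum_limitInit {ρ : ℝ} (hρ : 1 ≤ ρ) {α : ℕ → ℝ} (hα : ∀ n, 0 ≤ α n)
    (hα0 : ∃ n, α n ≠ 0) (hsum : Summable fun m : ℕ => (m : ℝ) * α m * ρ ^ m) :
    HasSum (limitInit α ρ) 1 := by
  have h := (summable_mul_chebRatio hρ hα hsum).hasSum.div_const (∑' n, α n * chebRatio ρ n)
  rwa [div_self (tsum_mul_chebRatio_pos hρ hα hα0 hsum).ne'] at h

lemma limitInit_nonneg {ρ : ℝ} (hρ : 1 ≤ ρ) {α : ℕ → ℝ} (hα : ∀ n, 0 ≤ α n) (n : ℕ) :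
    0 ≤ limitInit α ρ n :=
  div_nonneg (mul_nonneg (hα n) (chebRatio_pos hρ n).le)
    (tsum_nonneg fun m => mul_nonneg (hα m) (chebRatio_pos hρ m).le)

lemma exists_measure_of_hasSum {β : Type} [MeasurableSpace β] [MeasurableSingletonClass β]
    {p : β → ℝ} (hp : ∀ b, 0 ≤ p b) (hs : HasSum p 1) :
    ∃ μ : Measure β, IsProbabilityMeasure μ ∧ ∀ b, μ.real {b} = p b := by
  have h1 : ∑' b, ENNReal.ofReal (p b) = 1 := by
    rw [← ENNReal.ofReal_tsum_of_nonneg hp hs.summable, hs.tsum_eq, ENNReal.ofReal_one]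
  let q : PMF β := ⟨fun b => ENNReal.ofReal (p b), h1 ▸ ENNReal.summable.hasSum⟩
  refine ⟨q.toMeasure, inferInstance, fun b => ?_⟩
  rw [Measure.real, PMF.toMeasure_apply_singleton _ _ (measurableSet_singleton b)]
  exact ENNReal.toReal_ofReal (hp b)

/-- The chain driven by the noise `ω`: the entry `none` is the initial state and the entry
`some (k, n)` is the state that follows the state `n` at time `k`. -/
def drivenChain (ω : Option (ℕ × ℕ) → ℕ) : ℕ → ℕ
  | 0 => ω none
  | k + 1 => ω (some (k, drivenChain ω k))

lemma measurable_drivenChain (k : ℕ) : Measurable fun ω => drivenChain ω k := by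
  induction k with
  | zero => exact measurable_pi_apply none
  | succ k ih =>
    have h : Measurable fun p : ℕ × (Option (ℕ × ℕ) → ℕ) => p.2 (some (k, p.1)) :=
      measurable_from_prod_countable_right fun n =>
        show Measurable fun ω : Option (ℕ × ℕ) → ℕ => ω (some (k, n)) from measurable_pi_apply _
    exact h.comp (ih.prodMk measurable_id)

lemma drivenChain_eq_iff (x : ℕ → ℕ) (k : ℕ) (ω : Option (ℕ × ℕ) → ℕ) :
    (∀ j ≤ k, drivenChain ω j = x j) ↔
      ω none = x 0 ∧ ∀ j < k, ω (some (j, x j)) = x (j + 1) := by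
  constructor
  · intro h
    refine ⟨h 0 (by omega), fun j hj => ?_⟩
    have := h (j + 1) (by omega)
    rwa [drivenChain, h j (by omega)] at this
  · rintro ⟨h0, h⟩ j
    induction j with
    | zero => exact fun _ => h0
    | succ j ih =>
      intro hj
      rw [drivenChain, ih (by omega), h j (by omega)]

/-- A Markov chain exists for every stochastic kernel: drive it by independent noise in which the
coordinate `some (k, n)` has the law `Q n`. -/
lemma exists_isMarkovChain {ν : ℕ → ℝ} {Q : ℕ → ℕ → ℝ} (hν : ∀ n, 0 ≤ ν n) (hν1 : HasSum ν 1)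
    (hQ : ∀ n m, 0 ≤ Q n m) (hQ1 : ∀ n, HasSum (Q n) 1) :
    ∃ (Ω : Type) (_ : MeasurableSpace Ω) (P : Measure Ω) (_ : IsProbabilityMeasure P)
      (Z : ℕ → Ω → ℕ), IsMarkovChain P Z ν Q := by
  obtain ⟨μ₀, hμ₀, hμ₀'⟩ := exists_measure_of_hasSum hν hν1
  choose μ hμ hμ' using fun n => exists_measure_of_hasSum (hQ n) (hQ1 n)
  let κ : Option (ℕ × ℕ) → Measure ℕ := fun o => o.elim μ₀ fun p => μ p.2
  have hκ : ∀ o, IsProbabilityMeasure (κ o) := by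
    rintro (_ | p)
    · exact hμ₀
    · exact hμ p.2
  -- the event that the first `k` steps are prescribed fixes finitely many coordinates of the noise
  have hpath (x : ℕ → ℕ) (k : ℕ) :
      (Measure.infinitePi κ).real {ω | ∀ j ≤ k, drivenChain ω j = x j} =
        ν (x 0) * ∏ j ∈ Finset.range k, Q (x j) (x (j + 1)) := by
    let t : Option (ℕ × ℕ) → Set ℕ := fun o => o.elim {x 0} fun p => {x (p.1 + 1)}
    have hset : {ω : Option (ℕ × ℕ) → ℕ | ∀ j ≤ k, drivenChain ω j = x j} =
        Set.pi (Finset.insertNone ((Finset.range k).image fun j => (j, x j)) :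
          Finset (Option (ℕ × ℕ))) t := by
      ext ω
      rw [Set.mem_ofPred_eq, drivenChain_eq_iff]
      simp only [Set.mem_pi, Option.forall, SetLike.mem_coe, Finset.mem_insertNone, t]
      simp
    rw [hset, Measure.real, Measure.infinitePi_pi _ fun o _ => .of_discrete,
      Finset.prod_insertNone, Finset.prod_image fun i _ j _ h => (Prod.ext_iff.1 h).1,
      ENNReal.toReal_mul, ENNReal.toReal_prod, ← hμ₀']
    congr 1
    exact Finset.prod_congr rfl fun j _ => by rw [← hμ']; rfl
  refine ⟨Option (ℕ × ℕ) → ℕ, inferInstance, Measure.infinitePi κ, inferInstance,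
    fun k ω => drivenChain ω k, measurable_drivenChain, fun n => ?_, fun k x => ?_⟩
  · have h := hpath (fun _ => n) 0
    simpa using h
  · rw [hpath, hpath, Finset.prod_range_succ, mul_assoc]

lemma measurableSet_path {Ω : Type*} [MeasurableSpace Ω] {Z : ℕ → Ω → ℕ}
    (hZ : ∀ k, Measurable (Z k)) (x : ℕ → ℕ) (k : ℕ) :
    MeasurableSet {ω | ∀ j ≤ k, Z j ω = x j} := by
  simp only [Set.ofPred_forall]
  exact .iInter fun j => .iInter fun _ => hZ j (measurableSet_singleton _)

lemma exists_isLimitPair {σ ρ : ℝ} (hσ : 0 < σ) (hρ : 1 ≤ ρ) {α : ℕ → ℝ}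
    (hα : ∀ n, 0 ≤ α n) (hα0 : ∃ n, α n ≠ 0)
    (hsum : Summable fun m : ℕ => (m : ℝ) * α m * ρ ^ m) :
    ∃ (Ω : Type) (_ : MeasurableSpace Ω) (P' : Measure Ω) (_ : IsProbabilityMeasure P')
      (Z : ℕ → Ω → ℕ) (ξ : ℕ → Ω → ℤ), IsLimitPair P' σ ρ α Z ξ := by
  have hρ0 : 0 < ρ := by linarith
  obtain ⟨Ω, _, P, _, Z, hZ⟩ := exists_isMarkovChain (limitInit_nonneg hρ hα)
    (hasSum_limitInit hρ hα hα0 hsum) (limitKernel_nonneg hσ hρ) (hasSum_limitKernel hσ hρ)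
  obtain ⟨μ, _, hμ⟩ := exists_measure_of_hasSum (stepProb_nonneg hσ hρ0) (hasSum_stepProb hσ hρ0)
  let R : Measure (ℕ → ℤ) := Measure.infinitePi fun _ => μ
  have hfst {s : Set Ω} (hs : MeasurableSet s) :
      (P.prod R).real (Prod.fst ⁻¹' s) = P.real s :=
    measurePreserving_fst.measureReal_preimage hs.nullMeasurableSet
  have hev (k : ℕ) : MeasurePreserving (fun ω : Ω × (ℕ → ℤ) => ω.2 k) (P.prod R) μ :=
    (measurePreserving_eval_infinitePi (fun _ => μ) k).comp measurePreserving_snd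
  refine ⟨Ω × (ℕ → ℤ), inferInstance, P.prod R, inferInstance, fun k ω => Z k ω.1,
    fun k ω => ω.2 k, ⟨fun k => (hZ.measurable k).comp measurable_fst, fun n => ?_, fun k x => ?_⟩,
    fun k => (hev k).measurable, fun k e => ?_, ?_, ?_⟩
  · exact (hfst (hZ.measurable 0 (measurableSet_singleton n))).trans (hZ.init n)
  · have h := hZ.step k x
    rwa [← hfst (measurableSet_path hZ.measurable x (k + 1)),
      ← hfst (measurableSet_path hZ.measurable x k)] at h
  · rw [← hμ e]
    exact (hev k).measureReal_preimage (measurableSet_singleton e).nullMeasurableSet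
  · rw [iIndepFun_iff_map_fun_eq_infinitePi_map fun k => (hev k).measurable]
    simp only [(hev _).map_eq]
    exact measurePreserving_snd.map_eq
  · exact indepFun_prod (X := fun ω k => Z k ω) (Y := fun y : ℕ → ℤ => y)
      (measurable_pi_lambda _ hZ.measurable) measurable_id

/-! ### Convergence in distribution on the pair of sequence spaces -/

/-- The pairs of sequences whose first entries are prescribed. -/
def pairCylinder (K : ℕ) (x : ℕ → ℕ) (e : ℕ → ℤ) : Set ((ℕ → ℕ) × (ℕ → ℤ)) :=
  {p | (∀ j ≤ K, p.1 j = x j) ∧ ∀ j < K, p.2 j = e j}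

lemma isOpen_pairCylinder (K : ℕ) (x : ℕ → ℕ) (e : ℕ → ℤ) : IsOpen (pairCylinder K x e) := by
  have h : pairCylinder K x e =
      ((Set.Iic K).pi fun j => {x j}) ×ˢ ((Set.Iio K).pi fun j => {e j}) := by
    ext p; simp [pairCylinder, Set.mem_pi]
  rw [h]
  exact (isOpen_set_pi (Set.finite_Iic K) fun _ _ => isOpen_discrete _).prod
    (isOpen_set_pi (Set.finite_Iio K) fun _ _ => isOpen_discrete _)

lemma isPiSystem_pairCylinder :
    IsPiSystem {s | ∃ K x e, s = pairCylinder K x e} := by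
  rintro _ ⟨K, x, e, rfl⟩ _ ⟨K', x', e', rfl⟩ ⟨z, ⟨h1, h2⟩, ⟨h3, h4⟩⟩
  refine ⟨max K K', z.1, z.2, ?_⟩
  ext p
  constructor
  · rintro ⟨⟨g1, g2⟩, ⟨g3, g4⟩⟩
    refine ⟨fun j hj => ?_, fun j hj => ?_⟩
    · rcases le_max_iff.1 hj with hj | hj
      · rw [g1 j hj, h1 j hj]
      · rw [g3 j hj, h3 j hj]
    · rcases lt_max_iff.1 hj with hj | hj
      · rw [g2 j hj, h2 j hj]
      · rw [g4 j hj, h4 j hj]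
  · rintro ⟨g1, g2⟩
    exact ⟨⟨fun j hj => (g1 j (le_max_of_le_left hj)).trans (h1 j hj),
      fun j hj => (g2 j (lt_max_of_lt_left hj)).trans (h2 j hj)⟩,
      ⟨fun j hj => (g1 j (le_max_of_le_right hj)).trans (h3 j hj),
      fun j hj => (g2 j (lt_max_of_lt_right hj)).trans (h4 j hj)⟩⟩

lemma exists_pairCylinder_subset {u : Set ((ℕ → ℕ) × (ℕ → ℤ))} (hu : IsOpen u)
    {p : (ℕ → ℕ) × (ℕ → ℤ)} (hp : p ∈ u) : ∃ K, pairCylinder K p.1 p.2 ⊆ u := by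
  obtain ⟨v, w, hv, hw, hpv, hpw, hvw⟩ := isOpen_prod_iff.1 hu p.1 p.2 hp
  obtain ⟨I, f, hf, hI⟩ := isOpen_pi_iff.1 hv _ hpv
  obtain ⟨J, g, hg, hJ⟩ := isOpen_pi_iff.1 hw _ hpw
  refine ⟨(I ∪ J).sup id + 1, fun q hq => hvw ⟨hI fun i hi => ?_, hJ fun j hj => ?_⟩⟩
  · have : i ≤ (I ∪ J).sup id := Finset.le_sup (f := id) (Finset.mem_union_left J hi)
    rw [hq.1 i (by omega)]
    exact (hf i hi).2
  · have : j ≤ (I ∪ J).sup id := Finset.le_sup (f := id) (Finset.mem_union_right I hj)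
    rw [hq.2 j (by omega)]
    exact (hg j hj).2

/-- Convergence in distribution follows from convergence on the pair cylinders, a π-system of open
sets that is a base of the topology. -/
lemma tendstoInDistribution_of_pairCylinder {Ω : ℕ → Type*} [∀ L, MeasurableSpace (Ω L)]
    {Ω' : Type*} [MeasurableSpace Ω'] {P : ∀ L, Measure (Ω L)} [∀ L, IsProbabilityMeasure (P L)]
    {P' : Measure Ω'} [IsProbabilityMeasure P'] {X : ∀ L, Ω L → (ℕ → ℕ) × (ℕ → ℤ)}
    {Y : Ω' → (ℕ → ℕ) × (ℕ → ℤ)} (hX : ∀ L, Measurable (X L)) (hY : Measurable Y)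
    (h : ∀ K x e, Tendsto (fun L => (P L).real (X L ⁻¹' pairCylinder K x e)) atTop
      (𝓝 (P'.real (Y ⁻¹' pairCylinder K x e)))) :
    TendstoInDistribution X atTop Y P P' where
  forall_aemeasurable L := (hX L).aemeasurable
  aemeasurable_limit := hY.aemeasurable
  tendsto := by
    refine isPiSystem_pairCylinder.tendsto_probabilityMeasure_of_tendsto_of_mem ?_ ?_ ?_
    · rintro _ ⟨K, x, e, rfl⟩
      exact (isOpen_pairCylinder K x e).measurableSet
    · intro u hu p hp
      obtain ⟨K, hK⟩ := exists_pairCylinder_subset hu hp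
      exact ⟨_, ⟨K, p.1, p.2, rfl⟩, (isOpen_pairCylinder K _ _).mem_nhds
        ⟨fun _ _ => rfl, fun _ _ => rfl⟩, hK⟩
    · rintro _ ⟨K, x, e, rfl⟩
      have hm := (isOpen_pairCylinder K x e).measurableSet
      rw [← NNReal.tendsto_coe]
      convert h K x e using 1
      · funext L
        exact congrArg ENNReal.toReal (Measure.map_apply (hX L) hm)
      · congr 1
        exact congrArg ENNReal.toReal (Measure.map_apply hY hm)

/-- The limit probability of a pair cylinder. -/
lemma IsLimitPair.real_pairCylinder {Ω : Type*} [MeasurableSpace Ω] {P : Measure Ω}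
    {σ ρ : ℝ} {α : ℕ → ℝ} {Z : ℕ → Ω → ℕ}
    {ξ : ℕ → Ω → ℤ} (h : IsLimitPair P σ ρ α Z ξ) (K : ℕ) (x : ℕ → ℕ) (e : ℕ → ℤ) :
    P.real ((fun ω => ((fun k => Z k ω, fun k => ξ k ω) : (ℕ → ℕ) × (ℕ → ℤ))) ⁻¹'
        pairCylinder K x e) =
      (limitInit α ρ (x 0) * ∏ j ∈ Finset.range K, limitKernel σ ρ (x j) (x (j + 1))) *
        ∏ i ∈ Finset.range K, stepProb σ ρ (e i) := by
  have hZ (k : ℕ) : P.real {ω | ∀ j ≤ k, Z j ω = x j} =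
      limitInit α ρ (x 0) * ∏ j ∈ Finset.range k, limitKernel σ ρ (x j) (x (j + 1)) := by
    induction k with
    | zero =>
      rw [← h.chain.init]
      simp
    | succ k ih => rw [h.chain.step, ih, Finset.prod_range_succ, mul_assoc]
  have hξ : P.real {ω | ∀ j < K, ξ j ω = e j} =
      ∏ i ∈ Finset.range K, stepProb σ ρ (e i) := by
    have h1 := h.indep_step.measure_inter_preimage_eq_mul (Finset.range K)
      (sets := fun j => {e j}) fun j _ => measurableSet_singleton _
    have h2 : {ω | ∀ j < K, ξ j ω = e j} = ⋂ j ∈ Finset.range K, ξ j ⁻¹' {e j} := by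
      ext ω; simp
    rw [h2, Measure.real, h1, ENNReal.toReal_prod]
    exact Finset.prod_congr rfl fun j _ => h.law_step j (e j)
  have hs : MeasurableSet {z : ℕ → ℕ | ∀ j ≤ K, z j = x j} :=
    measurableSet_path (Z := fun j (z : ℕ → ℕ) => z j) measurable_pi_apply x K
  have ht : MeasurableSet {y : ℕ → ℤ | ∀ j < K, y j = e j} := by
    simp only [Set.ofPred_forall]
    exact .iInter fun j => .iInter fun _ => measurable_pi_apply j (measurableSet_singleton _)
  have h3 := h.indep.measure_inter_preimage_eq_mul _ _ hs ht
  rw [← hZ, ← hξ, Measure.real, Measure.real, Measure.real, ← ENNReal.toReal_mul]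
  exact congrArg ENNReal.toReal h3

end

/-! ### The joint limit -/

theorem theorem2 (σ ρ : ℝ) (hσ : 0 < σ) (hρ : 1 ≤ ρ)
    (α : ℕ → ℝ) (hα : ∀ n, 0 ≤ α n) (hα0 : ∃ n, α n ≠ 0)
    (hsum : Summable fun m : ℕ => (m : ℝ) * α m * ρ ^ m)
    (P : (L : ℕ) → Measure (MotzkinPath L))
    (hP : ∀ L, P L =
      MotzkinPath.law (fun _ => 1) (fun _ => σ) (fun _ => 1) α (fun n => ρ ^ n) L) :
    -- the random Motzkin paths are well defined
    ∃ _ : ∀ L, IsProbabilityMeasure (P L),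
      -- the laws of the right end points are not tight
      ¬ IsTightMeasureSet {μ : Measure ℕ | ∃ L, 1 ≤ L ∧ μ = (P L).map MotzkinPath.rightEnd} ∧
      -- the limiting pair of processes exists
      (∃ (Ω : Type) (_ : MeasurableSpace Ω) (P' : Measure Ω) (_ : IsProbabilityMeasure P')
        (Z : ℕ → Ω → ℕ) (ξ : ℕ → Ω → ℤ), IsLimitPair P' σ ρ α Z ξ) ∧
      -- and it is the joint limit in distribution of the boundary processes
      ∀ (Ω : Type*) [MeasurableSpace Ω] (P' : Measure Ω) [IsProbabilityMeasure P']
        (Z : ℕ → Ω → ℕ) (ξ : ℕ → Ω → ℤ), IsLimitPair P' σ ρ α Z ξ →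
        TendstoInDistribution
          (fun (L : ℕ) (γ : MotzkinPath L) =>
            ((fun k => γ.left k, fun k => γ.reversedStep k) : (ℕ → ℕ) × (ℕ → ℤ)))
          atTop (fun ω => ((fun k => Z k ω, fun k => ξ k ω) : (ℕ → ℕ) × (ℕ → ℤ))) P P' := by
  obtain rfl : P = fun L =>
      MotzkinPath.law (fun _ => 1) (fun _ => σ) (fun _ => 1) α (fun n => ρ ^ n) L := funext hP
  have hprob := fun L => MotzkinPath.isProbabilityMeasure_law hσ hρ hα hα0 hsum L
  refine ⟨hprob,
    MotzkinPath.not_isTight_rightEnd hσ hρ hα hα0 hsum,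
    exists_isLimitPair hσ hρ hα hα0 hsum, ?_⟩
  intro Ω _ P' _ Z ξ h
  refine tendstoInDistribution_of_pairCylinder (fun L => measurable_from_top)
    ((measurable_pi_lambda _ h.chain.measurable).prodMk
      (measurable_pi_lambda _ h.measurable_step)) fun K x e => ?_
  rw [h.real_pairCylinder]
  exact MotzkinPath.tendsto_law_boundaryEvent hσ hρ hα hα0 hsum K x e
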